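/- We work over $\mathbb C$. Let $B$ be an irreducible variety (an integral separated scheme of finite type over $\mathbb C$); "point" means closed point, and "a general point (or fibre)" means all those over some nonempty Zariski-open subset of $B$. A (parametric) scroll over $B$ in $\mathbb P^N$ with fibre dimension $k\ge 0$ is given by a classifying morphism $B\to\mathbb G(k,N)$, $b\mapsto \mathbb P(W_b)$, with $W_b\subset\mathbb C^{N+1}$ of dimension $k+1$; write $X=\{(b,x): x\in\mathbb P(W_b)\}\to B$ for the induced $\mathbb P^k$-bundle, with fibres $X_b$, and $f:X\to\mathbb P^N$, $f(b,x)=x$, for the spreading map. The scroll is called stationary if, for general $b\in B$, the image of the derivative $d_xf$, regarded as a linear subspace of $\mathbb P^N$ through $f(x)$ (the embedded image of the tangent space $T_xX$), is the same for all $x$ in some dense open subset of $X_b$. The focal locus is the ramification locus of $f$, i.e. the set of $x\in X$ at which $d_xf$ is not injective. On a general fibre $X_b\cong\mathbb P^k$ it has the scheme structure of a degeneracy locus: if $s_0,\dots,s_k$ is a regular frame of $W$ near $b$ and $D_1,\dots,D_m$ is a basis of $T_bB$, $m=\dim B$, it is defined by the maximal minors of the $(N+1)\times(k+1+m)$ matrix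 with columns $s_0(b),\dots,s_k(b)$ and $\sum_i\lambda_iD_a(s_i)$, $a=1,\dots,m$, where $\lambda_0,\dots,\lambda_k$ are the homogeneous coordinates on $X_b$. We say that the focal locus meets $X_b$ in a hypersurface if the set of focal points on $X_b$ is the zero set of a form of positive degree; each component of this hypersurface is counted with its multiplicity in the focal scheme (so that the hypersurface, as a divisor, is the largest effective divisor contained in that scheme), and its degree is the degree of this divisor. **Theorem.** Let $f:X/B\to\mathbb P^N$ be a scroll with $f$ generically finite to its image. Suppose that the focal locus of $f$ meets a general fibre of $X/B$ in a hypersurface. Then, for general $b\in B$, this hypersurface in $X_b$ has degree at most $\dim B$, and its degree equals $\dim B$ if and only if the scroll is stationary. -/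

import Mathlib

open AlgebraicGeometry CategoryTheory LinearAlgebra.Projectivization

noncomputable section

/-- A complex-valued point of a scheme `B` over `Spec ℂ` (for `B` locally of finite type over `ℂ`
this is the same thing as a closed point of `B`). -/
structure CPoint {B : Scheme.{0}} (π : B ⟶ Spec (.of ℂ)) where
  hom : Spec (.of ℂ) ⟶ B
  isSection : hom ≫ π = 𝟙 (Spec (.of ℂ))

namespace CPoint

variable {B : Scheme.{0}} {π : B ⟶ Spec (.of ℂ)}

/-- The underlying point of the scheme. -/
def pt (b : CPoint π) : B := b.hom (IsLocalRing.closedPoint ℂ)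

/-- The local ring `𝒪_{B,b}`. -/
abbrev LocalRing (b : CPoint π) : Type := B.presheaf.stalk b.pt

/-- Evaluation of germs at `b`. -/
def ev (b : CPoint π) : b.LocalRing →+* ℂ := (Scheme.stalkClosedPointTo b.hom).hom

/-- The germ at `b` of a function that is regular on an open set containing `b`. -/
def germ (b : CPoint π) {U : B.Opens} (hb : b.pt ∈ U) : Γ(B, U) →+* b.LocalRing :=
  (B.presheaf.germ U b.pt hb).hom

/-- The value at `b` of a function that is regular on an open set containing `b`. -/
def value (b : CPoint π) {U : B.Opens} (hb : b.pt ∈ U) : Γ(B, U) →+* ℂ :=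
  b.ev.comp (b.germ hb)

/-- The germ at `b` of a constant function. -/
def const (b : CPoint π) : ℂ →+* b.LocalRing :=
  (b.germ (U := ⊤) trivial).comp (π.appTop.hom.comp (Scheme.ΓSpecIso (.of ℂ)).inv.hom)

/-- The Zariski tangent space `T_b B`: the `ℂ`-derivations `𝒪_{B,b} → ℂ` at the point `b`. -/
def tangentSpace (b : CPoint π) : Submodule ℂ (b.LocalRing → ℂ) where
  carrier := {D | (∀ f g, D (f + g) = D f + D g) ∧
    (∀ f g, D (f * g) = b.ev f * D g + b.ev g * D f) ∧ ∀ c, D (b.const c) = 0}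
  zero_mem' := by simp
  add_mem' := by
    rintro D E ⟨h1, h2, h3⟩ ⟨k1, k2, k3⟩
    refine ⟨fun f g => ?_, fun f g => ?_, fun c => ?_⟩
    · simp only [Pi.add_apply, h1, k1]; ring
    · simp only [Pi.add_apply, h2, k2]; ring
    · simp only [Pi.add_apply, h3, k3, add_zero]
  smul_mem' := by
    rintro a D ⟨h1, h2, h3⟩
    refine ⟨fun f g => ?_, fun f g => ?_, fun c => ?_⟩
    · simp only [Pi.smul_apply, smul_eq_mul, h1]; ring
    · simp only [Pi.smul_apply, smul_eq_mul, h2]; ring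
    · simp only [Pi.smul_apply, smul_eq_mul, h3, mul_zero]

end CPoint

/-- A property holds for the general (complex) point of the irreducible variety `B` if it holds
for all points of some nonempty (hence dense) Zariski-open subset. -/
def ForGeneral {B : Scheme.{0}} (π : B ⟶ Spec (.of ℂ)) (P : CPoint π → Prop) : Prop :=
  ∃ U : B.Opens, (U : Set B).Nonempty ∧ ∀ b : CPoint π, b.pt ∈ U → P b

/-- A regular local frame, over an open set `U`, of a family `W` of linear subspaces of
`ℂ^{N+1}` parametrized by the points of `B`: regular maps `s₀, …, s_k : U → ℂ^{N+1}` whose values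
at each point `b` of `U` form a basis of `W b`. -/
structure LocalFrame {B : Scheme.{0}} (π : B ⟶ Spec (.of ℂ)) (k N : ℕ)
    (W : CPoint π → Submodule ℂ (Fin (N + 1) → ℂ)) where
  U : B.Opens
  s : Fin (k + 1) → Fin (N + 1) → Γ(B, U)
  linearIndependent : ∀ (b : CPoint π) (hb : b.pt ∈ U),
    LinearIndependent ℂ fun i : Fin (k + 1) => fun j : Fin (N + 1) => b.value hb (s i j)
  span_eq : ∀ (b : CPoint π) (hb : b.pt ∈ U),
    Submodule.span ℂ (Set.range fun i : Fin (k + 1) => fun j : Fin (N + 1) =>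
      b.value hb (s i j)) = W b

/-- A parametric scroll over `B` in `ℙ^N` with fibres `ℙ^k`, given by its classifying morphism
`B → 𝔾(k, N)`, `b ↦ ℙ(W b)`. Regularity of that map means that the tautological
`(k+1)`-dimensional subspaces `W b ⊆ ℂ^{N+1}` have regular frames locally on `B`. -/
structure ParametricScroll {B : Scheme.{0}} (π : B ⟶ Spec (.of ℂ)) (k N : ℕ) where
  W : CPoint π → Submodule ℂ (Fin (N + 1) → ℂ)
  regular : ∀ b : CPoint π, ∃ φ : LocalFrame π k N W, b.pt ∈ φ.U

namespace ParametricScroll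

variable {B : Scheme.{0}} {π : B ⟶ Spec (.of ℂ)} {k N : ℕ} (S : ParametricScroll π k N)

/-- The points of the total space `X` of the induced `ℙ^k`-bundle `X → B`:
pairs of a point `b` of `B` and a point of `ℙ(W b)`. -/
@[ext] structure Total where
  base : CPoint π
  point : ℙ ℂ (Fin (N + 1) → ℂ)
  mem : point.submodule ≤ S.W base

/-- The spreading map `f : X → ℙ^N`. -/
def spread (x : S.Total) : ℙ ℂ (Fin (N + 1) → ℂ) := x.point

/-- `c` is a vector of homogeneous coordinates, with respect to the local frame `φ`, of the point
`x` of `X`: that is, `x` is the point `[c₀ s₀(b) + ⋯ + c_k s_k(b)]` of the fibre over `b`. -/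
def IsCoord (φ : LocalFrame π k N S.W) (x : S.Total) (hx : x.base.pt ∈ φ.U)
    (c : Fin (k + 1) → ℂ) : Prop :=
  Submodule.span ℂ {fun j : Fin (N + 1) => ∑ i, c i * x.base.value hx (φ.s i j)} =
    x.point.submodule

/-- The Zariski topology of `X`. The local frame `φ` identifies the part of `X` over `φ.U` with
`φ.U × ℙ^k`, and a homogeneous polynomial `p` in the fibre coordinates with coefficients in
`Γ(B, φ.U)` gives a basic open set, the locus where `p` does not vanish. -/
instance : TopologicalSpace S.Total := TopologicalSpace.generateFrom
  {V | ∃ (φ : LocalFrame π k N S.W) (d : ℕ) (p : MvPolynomial (Fin (k + 1)) Γ(B, φ.U)),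
    p.IsHomogeneous d ∧ V = {x | ∃ (hx : x.base.pt ∈ φ.U) (c : Fin (k + 1) → ℂ),
      S.IsCoord φ x hx c ∧ MvPolynomial.eval₂ (x.base.value hx) c p ≠ 0}}

/-- The fibre `X_b ≅ ℙ^k`, with the topology induced from `X`. -/
abbrev Fibre (b : CPoint π) : Type := {x : S.Total // x.base = b}

/-- `f` is generically finite to its image: the fibre of `f` through each point of some nonempty
(hence dense) open subset of `X` is finite. -/
def GenericallyFinite : Prop :=
  ∃ V : Set S.Total, IsOpen V ∧ V.Nonempty ∧
    ∀ x ∈ V, {y : S.Total | S.spread y = S.spread x}.Finite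

/-- A local frame near `b`. What is defined through it below does not depend on its choice, except
for a linear change of the homogeneous coordinates on the fibre `X_b`. -/
def frame (b : CPoint π) : LocalFrame π k N S.W := (S.regular b).choose

lemma mem_frame (b : CPoint π) : b.pt ∈ (S.frame b).U := (S.regular b).choose_spec

/-- The value at `b` of the `i`-th member of the frame near `b`, a vector of `ℂ^{N+1}`. -/
def frameVec (b : CPoint π) (i : Fin (k + 1)) : Fin (N + 1) → ℂ :=
  fun j => b.value (S.mem_frame b) ((S.frame b).s i j)

/-- The derivative at `b` of the `i`-th member of the frame near `b`,
a linear map `T_b B → ℂ^{N+1}`. -/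
def frameDeriv (b : CPoint π) (i : Fin (k + 1)) :
    b.tangentSpace →ₗ[ℂ] (Fin (N + 1) → ℂ) where
  toFun D := fun j => D.1 (b.germ (S.mem_frame b) ((S.frame b).s i j))
  map_add' _ _ := rfl
  map_smul' _ _ := rfl

/-- `c` is a vector of homogeneous coordinates of the point `x` of the fibre `X_b`. -/
def IsFibreCoord {b : CPoint π} (x : S.Fibre b) (c : Fin (k + 1) → ℂ) : Prop :=
  Submodule.span ℂ {∑ i, c i • S.frameVec b i} = x.1.point.submodule

/-- The derivative of the spreading map over `b`, on affine cones: the derivative at `(b, c)` of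
`(b, c) ↦ c₀ s₀(b) + ⋯ + c_k s_k(b)`, from `ℂ^{k+1} × T_b B` to `ℂ^{N+1}`.
For `x = (b, [c])` in `X`, its image is the affine cone over the image of `d_x f`, regarded as a
linear subspace of `ℙ^N` through `f x`; and it is injective if and only if `d_x f` is (the
derivative is injective on the line spanned by `c`, which is what is divided out on passing
to projective spaces). -/
def coneDeriv (b : CPoint π) (c : Fin (k + 1) → ℂ) :
    ((Fin (k + 1) → ℂ) × b.tangentSpace) →ₗ[ℂ] (Fin (N + 1) → ℂ) :=
  (∑ i, (LinearMap.proj i : (Fin (k + 1) → ℂ) →ₗ[ℂ] ℂ).smulRight (S.frameVec b i)).coprod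
    (∑ i, c i • S.frameDeriv b i)

/-- The scroll is stationary: for general `b`, the image of `d_x f`, as a linear subspace of
`ℙ^N`, does not depend on `x` as `x` varies in some dense open subset of the fibre `X_b`. -/
def IsStationary : Prop :=
  ForGeneral π fun b => ∃ V : Set (S.Fibre b), IsOpen V ∧ Dense V ∧
    ∃ T : Submodule ℂ (Fin (N + 1) → ℂ), ∀ x ∈ V, ∀ c, S.IsFibreCoord x c →
      LinearMap.range (S.coneDeriv b c) = T

/-- The focal locus of the scroll, on the fibre `X_b`: the set of points at which `f` is ramified,
that is, at which its derivative is not injective. -/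
def focalLocus (b : CPoint π) : Set (S.Fibre b) :=
  {x | ∃ c, S.IsFibreCoord x c ∧ ¬ Function.Injective (S.coneDeriv b c)}

/-- The derivative of `f` over `b` (on affine cones) as a matrix of forms in the homogeneous
coordinates of the fibre `X_b`: the columns are the vectors `sᵢ(b)` and, for the
given tangent vectors `D₁, …, D_m` of `B` at `b`, the vectors `∑ᵢ λᵢ D_a(sᵢ)`. -/
def derivMatrix (b : CPoint π) {m : ℕ} (D : Fin m → b.tangentSpace) :
    Matrix (Fin (N + 1)) (Fin (k + 1) ⊕ Fin m) (MvPolynomial (Fin (k + 1)) ℂ) :=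
  Matrix.of fun j => Sum.elim (fun i => MvPolynomial.C (S.frameVec b i j))
    fun a => ∑ i, MvPolynomial.C (S.frameDeriv b i (D a) j) * MvPolynomial.X i

/-- The homogeneous ideal of the focal locus on the fibre `X_b` with its natural scheme structure,
as a degeneracy locus of the derivative of `f`: it is generated by the maximal minors
(`k + 1 + dim T_b B` columns) of the matrix of the derivative. -/
def focalIdeal (b : CPoint π) : Ideal (MvPolynomial (Fin (k + 1)) ℂ) :=
  Ideal.span {p | ∃ (D : Fin (Module.finrank ℂ b.tangentSpace) → b.tangentSpace)
    (r : Fin (k + 1) ⊕ Fin (Module.finrank ℂ b.tangentSpace) → Fin (N + 1)),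
    p = ((S.derivMatrix b D).submatrix r id).det}

/-- The focal locus meets the fibre `X_b` in the hypersurface `g = 0` of degree `d > 0`
(counted with multiplicities): the set of focal points on `X_b` is the zero set of the nonzero
form `g` of degree `d`, and each component has in `g` the multiplicity that it has in the focal
scheme, i.e. `g = 0` is the largest effective divisor contained in the focal scheme. -/
structure IsFocalHypersurface (b : CPoint π) (d : ℕ) (g : MvPolynomial (Fin (k + 1)) ℂ) :
    Prop where
  pos : 0 < d
  ne_zero : g ≠ 0
  homogeneous : g.IsHomogeneous d
  mem_focalLocus_iff : ∀ (x : S.Fibre b) (c : Fin (k + 1) → ℂ), S.IsFibreCoord x c →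
    (x ∈ S.focalLocus b ↔ MvPolynomial.eval c g = 0)
  le_span : S.focalIdeal b ≤ Ideal.span {g}
  dvd_of_le : ∀ h : MvPolynomial (Fin (k + 1)) ℂ, S.focalIdeal b ≤ Ideal.span {h} → h ∣ g

end ParametricScroll

end

/-! Along a fibre the derivative of the spreading map is a matrix with k + 1 constant columns (the
frame) and m = dim B columns linear in the coordinates (the derivatives of the frame along a basis
of the tangent space), so every maximal minor is a form of degree m. The focal form g is a greatest
common divisor of these minors, and they do not all vanish because g ≠ 0. Hence d ≤ m (`degree_le`).

If d = m, each minor is a constant times g: up to scale, the Plücker coordinates of the image do not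
move along the fibre. Where they do not vanish they determine the image, which is therefore constant
(`IsFocalHypersurface.proportionalMinors`, `isStationaryAt_of_proportionalMinors`). Conversely, if
the image is a fixed T on a dense open set, then T contains the frame and all its derivatives, and
the matrix factors as a constant matrix times a square matrix Q of forms. All minors are multiples
of det Q, a form of degree m, so det Q divides g and m ≤ d (`le_degree`).

These arguments concern one fibre, while stationarity concerns the general one. Over an open set
with a fixed frame and fixed vector fields, proportionality of the minors is the vanishing of
regular functions on the irreducible base, so it holds for general b or fails for general b
(`forGeneral_proportionalMinors`). This requires vector fields that form a basis of the tangent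
space at each point, which come from étale coordinates (`exists_tangentFrame`), and independence of
the frame (`LocalFrame.proportionalMinors`). -/

section Algebra

/-! ### Étale coordinates and dimension of finitely generated domains. -/

open Order in
theorem ringKrullDim_eq_of_isIntegral_of_injective {R S : Type*} [CommRing R] [CommRing S]
    [IsDomain R] [IsDomain S] [Algebra R S] [Algebra.IsIntegral R S]
    (hinj : Function.Injective (algebraMap R S)) : ringKrullDim S = ringKrullDim R := by
  -- Incomparability makes contraction of primes strictly monotone, which bounds the dimension
  -- above; lying over and going up lift chains, which bounds it below.
  apply le_antisymm
  · refine krullDim_le_of_strictMono (PrimeSpectrum.comap (algebraMap R S)) fun p q hpq => ?_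
    exact Ideal.IsIntegral.comap_lt_comap (R := R) (I := p.asIdeal) (J := q.asIdeal) hpq
  · refine iSup_le fun l => ?_
    obtain ⟨P, hP, hPl⟩ := Ideal.exists_ideal_over_prime_of_isIntegral_of_isDomain (S := S)
      (l.head).asIdeal (by rw [(RingHom.injective_iff_ker_eq_bot _).mp hinj]; exact bot_le)
    have : P.LiesOver (l.head).asIdeal := ⟨hPl.symm⟩
    obtain ⟨L, hL, -⟩ := Ideal.exists_ltSeries_of_hasGoingUp (S := S) l P
    rw [← hL]
    exact L.length_le_krullDim

/-- A finite injective extension of domains of characteristic zero is étale over a nonempty open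
subset of the source. -/
theorem exists_etale_localizationAway {P A : Type} [CommRing P] [CommRing A] [IsDomain P]
    [IsDomain A] [CharZero P] [IsNoetherianRing P] [Algebra P A] [Module.Finite P A]
    (hinj : Function.Injective (algebraMap P A)) :
    ∃ f : A, f ≠ 0 ∧ Algebra.Etale P (Localization.Away f) := by
  have : FaithfulSMul P A := (faithfulSMul_iff_algebraMap_injective P A).mpr hinj
  have : Algebra.FinitePresentation P A := Algebra.FinitePresentation.of_finiteType.mp inferInstance
  have : CharZero (FractionRing P) :=
    charZero_of_injective_algebraMap (IsFractionRing.injective P (FractionRing P))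
  have : Algebra.IsAlgebraic P (FractionRing A) :=
    have : Algebra.IsAlgebraic A (FractionRing A) :=
      IsLocalization.isAlgebraic (R := A) (S := FractionRing A) (M := nonZeroDivisors A)
    Algebra.IsAlgebraic.trans P A (FractionRing A)
  let := FractionRing.liftAlgebra P (FractionRing A)
  have := FractionRing.isScalarTower_liftAlgebra P (FractionRing A)
  have : Algebra.IsAlgebraic (FractionRing P) (FractionRing A) := by
    exact Algebra.IsAlgebraic.extendScalars (R := P) (IsFractionRing.injective P (FractionRing P))
  have : Algebra.FormallyEtale (FractionRing P) (FractionRing A) :=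
    Algebra.FormallyEtale.of_isSeparable _ _
  have : Algebra.FormallyEtale P (FractionRing P) :=
    Algebra.FormallyEtale.of_isLocalization (nonZeroDivisors P)
  have h1 : Algebra.FormallyEtale P (FractionRing A) := Algebra.FormallyEtale.comp P (FractionRing P) _
  have h2 : IsLocalization (⊥ : Ideal A).primeCompl (FractionRing A) := by
    rw [show (⊥ : Ideal A).primeCompl = nonZeroDivisors A by
      ext x; simp [Ideal.primeCompl]]
    infer_instance
  -- The local ring at the zero ideal is the fraction field, étale over `P` because the extension of
  -- fraction fields is separable in characteristic zero. Étaleness at the generic point then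
  -- spreads to a neighbourhood.
  have h3 : Algebra.IsEtaleAt P (⊥ : Ideal A) :=
    Algebra.FormallyEtale.of_equiv ((IsLocalization.algEquiv (⊥ : Ideal A).primeCompl
      (FractionRing A) (Localization.AtPrime (⊥ : Ideal A))).restrictScalars P)
  obtain ⟨f, hf, hE⟩ := Algebra.exists_etale_of_isEtaleAt (R := P) (⊥ : Ideal A)
  exact ⟨f, hf, hE⟩

/-- Étale coordinates: functions whose differentials are a basis of the Kähler differentials. -/
theorem exists_basis_kaehlerDifferential_of_etale {K A : Type} [CommRing K] [CommRing A] {n : ℕ}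
    [Algebra K A] [Algebra (MvPolynomial (Fin n) K) A] [IsScalarTower K (MvPolynomial (Fin n) K) A]
    [Algebra.FormallyEtale (MvPolynomial (Fin n) K) A] :
    ∃ (x : Fin n → A) (ω : Module.Basis (Fin n) A (Ω[A⁄K])), ∀ i, ω i = KaehlerDifferential.D K A (x i) := by
  refine ⟨fun i => algebraMap (MvPolynomial (Fin n) K) A (.X i),
    ((KaehlerDifferential.mvPolynomialBasis K (Fin n)).baseChange A).map
      (KaehlerDifferential.tensorKaehlerEquivOfFormallyEtale K (MvPolynomial (Fin n) K) A), fun i => ?_⟩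
  simp

/-- Dual étale coordinates and vector fields. -/
theorem exists_derivations_of_basis {K A : Type} [CommRing K] [CommRing A] {n : ℕ} [Algebra K A]
    (x : Fin n → A) (ω : Module.Basis (Fin n) A (Ω[A⁄K]))
    (hω : ∀ i, ω i = KaehlerDifferential.D K A (x i)) :
    ∃ δ : Fin n → Derivation K A A, (∀ a i, δ a (x i) = if a = i then 1 else 0) ∧
      ∀ (M : Type) [AddCommGroup M] [Module K M] [Module A M] [IsScalarTower K A M]
        (D : Derivation K A M) (y : A), D y = ∑ a, δ a y • D (x a) := by
  refine ⟨fun a => (ω.coord a).compDer (KaehlerDifferential.D K A), fun a i => ?_, ?_⟩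
  · simp [← hω, Finsupp.single_apply, eq_comm]
  · intro M _ _ _ _ D y
    have h : D.liftKaehlerDifferential (KaehlerDifferential.D K A y) =
      D.liftKaehlerDifferential (∑ a, ω.repr (KaehlerDifferential.D K A y) a • ω a) := by
      rw [ω.sum_repr]
    rw [Derivation.liftKaehlerDifferential_comp_D] at h
    rw [h, map_sum]
    simp [hω]

/-- A complex variety has, over a nonempty affine open subset, étale coordinates whose number is
its dimension. -/
theorem exists_etale_coordinates (A : Type) [CommRing A] [IsDomain A] [Algebra ℂ A]
    [Algebra.FiniteType ℂ A] : ∃ (n : ℕ) (f : A), f ≠ 0 ∧ ringKrullDim A = n ∧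
      Algebra.trdeg ℂ A = n ∧
      ∀ (A' : Type) [CommRing A'] [Algebra A A'] [Algebra ℂ A'] [IsScalarTower ℂ A A']
        [IsLocalization.Away f A'],
      ∃ (x : Fin n → A') (δ : Fin n → Derivation ℂ A' A'),
        (∀ a i, δ a (x i) = if a = i then 1 else 0) ∧
      ∀ (M : Type) [AddCommGroup M] [Module ℂ M] [Module A' M]
        [IsScalarTower ℂ A' M] (D : Derivation ℂ A' M) (y : A'),
        D y = ∑ a, δ a y • D (x a) := by
  obtain ⟨n, g, hg, hfin⟩ := exists_finite_inj_algHom_of_fg ℂ A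
  algebraize [g.toRingHom]
  have : IsScalarTower ℂ (MvPolynomial (Fin n) ℂ) A := .of_algebraMap_eq' g.comp_algebraMap.symm
  have hg' : Function.Injective (algebraMap (MvPolynomial (Fin n) ℂ) A) := hg
  have : Module.Finite (MvPolynomial (Fin n) ℂ) A := hfin
  obtain ⟨f, hf, hE⟩ := exists_etale_localizationAway hg'
  refine ⟨n, f, hf, ?_, ?_, ?_⟩
  · rw [ringKrullDim_eq_of_isIntegral_of_injective hg']
    simp
  · have : FaithfulSMul (MvPolynomial (Fin n) ℂ) A :=
      (faithfulSMul_iff_algebraMap_injective _ A).mpr hg'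
    rw [← trdeg_add_eq ℂ (MvPolynomial (Fin n) ℂ),
      trdeg_eq_zero (R := MvPolynomial (Fin n) ℂ) (A := A)]
    simp
  -- Any model of the localization is allowed, so that `A'` can be the ring of functions on a basic
  -- open set.
  · intro A' _ _ _ _ _
    let := ((algebraMap A A').comp (algebraMap (MvPolynomial (Fin n) ℂ) A)).toAlgebra
    have : IsScalarTower (MvPolynomial (Fin n) ℂ) A A' := .of_algebraMap_eq' rfl
    have : IsScalarTower ℂ (MvPolynomial (Fin n) ℂ) A' := .to₁₂₄ _ _ A _
    have : Algebra.FormallyEtale (MvPolynomial (Fin n) ℂ) A' :=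
      Algebra.FormallyEtale.of_equiv ((IsLocalization.algEquiv (.powers f)
        (Localization.Away f) A').restrictScalars (MvPolynomial (Fin n) ℂ))
    obtain ⟨x, ω, hω⟩ := exists_basis_kaehlerDifferential_of_etale (K := ℂ) (A := A') (n := n)
    obtain ⟨δ, h⟩ := exists_derivations_of_basis x ω hω
    exact ⟨x, δ, h⟩

/-- The Krull dimension of a finitely generated complex domain only depends on its field of
fractions. -/
theorem ringKrullDim_eq_of_isFractionRing {A A' K : Type} [CommRing A] [IsDomain A] [Algebra ℂ A]
    [Algebra.FiniteType ℂ A] [CommRing A'] [IsDomain A'] [Algebra ℂ A'] [Algebra.FiniteType ℂ A']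
    [Field K] [Algebra ℂ K] [Algebra A K] [Algebra A' K] [IsScalarTower ℂ A K]
    [IsScalarTower ℂ A' K] [IsFractionRing A K] [IsFractionRing A' K] :
    ringKrullDim A = ringKrullDim A' := by
  -- The dimension equals the transcendence degree, which only sees the fraction field.
  have aux : ∀ (R : Type) [CommRing R] [IsDomain R] [Algebra ℂ R] [Algebra R K]
      [IsScalarTower ℂ R K] [IsFractionRing R K], Algebra.trdeg ℂ R = Algebra.trdeg ℂ K := by
    intro R _ _ _ _ _ _
    have : FaithfulSMul R K :=
      (faithfulSMul_iff_algebraMap_injective _ _).mpr (IsFractionRing.injective R K)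
    have : Algebra.IsAlgebraic R K :=
      IsLocalization.isAlgebraic (R := R) (S := K) (M := nonZeroDivisors R)
    rw [← trdeg_add_eq ℂ R (A := K), trdeg_eq_zero (R := R) (A := K), add_zero]
  obtain ⟨n, _, -, hn, hn', -⟩ := exists_etale_coordinates A
  obtain ⟨m, _, -, hm, hm', -⟩ := exists_etale_coordinates A'
  rw [aux] at hn' hm'
  rw [hn, hm, Nat.cast_injective (hn'.symm.trans hm')]

end Algebra

/-! ### Dimension of the base and abundance of complex points. -/

section Dimension

open TopologicalSpace Order in
/-- The Krull dimension of a nonempty space can be computed on an open cover. -/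
theorem topologicalKrullDim_eq_of_forall_exists_open {X : Type*} [TopologicalSpace X] [Nonempty X]
    {n : WithBot ℕ∞} (h : ∀ x : X, ∃ U : Opens X, x ∈ U ∧ topologicalKrullDim U = n) :
    topologicalKrullDim X = n := by
  apply le_antisymm
  -- Every irreducible closed set above `Z` meets an open set that meets `Z`, so the coheight of `Z`
  -- can be computed in that open set.
  · rw [topologicalKrullDim, krullDim_eq_iSup_coheight]
    refine iSup_le fun Z => ?_
    obtain ⟨x, hx⟩ := Z.isIrreducible.nonempty
    obtain ⟨U, hxU, hU⟩ := h x
    have hemb : Topology.IsOpenEmbedding (Subtype.val : U → X) := U.isOpenEmbedding'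
    obtain ⟨Z', hZ'⟩ := (IrreducibleCloseds.orderIsoOfIsOpenEmbedding _ hemb).surjective
      ⟨Z, ⟨⟨x, hxU⟩, hx⟩⟩
    have : IrreducibleCloseds.map _ hemb.continuous Z' = Z := congrArg Subtype.val hZ'
    rw [← this, hemb.coheight_map, ← hU, topologicalKrullDim, krullDim_eq_iSup_coheight]
    exact le_iSup (fun Z : IrreducibleCloseds U => ((coheight Z : ℕ∞) : WithBot ℕ∞)) Z'
  · obtain ⟨U, -, hU⟩ := h (Classical.arbitrary X)
    rw [← hU]
    exact topologicalKrullDim_subspace_le X U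

theorem AlgebraicGeometry.IsAffineOpen.topologicalKrullDim_eq {X : Scheme.{0}} {U : X.Opens} (hU : IsAffineOpen U) :
    topologicalKrullDim U = ringKrullDim Γ(X, U) := by
  rw [← PrimeSpectrum.topologicalKrullDim_eq_ringKrullDim]
  exact IsHomeomorph.topologicalKrullDim_eq _ (Scheme.homeoOfIso hU.isoSpec).isHomeomorph

variable {B : Scheme.{0}} (π : B ⟶ Spec (.of ℂ))

/-- The constant functions on an open subset. -/
noncomputable def constHom (U : B.Opens) : ℂ →+* Γ(B, U) :=
  (B.presheaf.map (homOfLE le_top : U ⟶ ⊤).op).hom.comp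
    (π.appTop.hom.comp (Scheme.ΓSpecIso (.of ℂ)).inv.hom)

theorem finiteType_constHom [LocallyOfFiniteType π] {U : B.Opens} (hU : IsAffineOpen U) :
    (constHom π U).FiniteType := by
  have h := π.finiteType_appLE (isAffineOpen_top (Spec (.of ℂ))) hU le_top
  exact h.comp (RingHom.FiniteType.of_surjective (Scheme.ΓSpecIso (.of ℂ)).inv.hom
    (ConcreteCategory.bijective_of_isIso (Scheme.ΓSpecIso (.of ℂ)).inv).surjective)

theorem map_constHom {U V : B.Opens} (i : V ⟶ U) (c : ℂ) :
    (B.presheaf.map i.op).hom (constHom π U c) = constHom π V c := by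
  simp only [constHom, RingHom.comp_apply]
  rw [← CommRingCat.comp_apply, ← B.presheaf.map_comp]
  rfl

theorem germ_map {b : CPoint π} {U V : B.Opens} (i : V ⟶ U) (hb : b.pt ∈ V) (f : Γ(B, U)) :
    b.germ hb ((B.presheaf.map i.op).hom f) = b.germ (i.le hb) f :=
  TopCat.Presheaf.germ_res_apply B.presheaf i b.pt hb f

theorem germ_constHom (b : CPoint π) {U : B.Opens} (hb : b.pt ∈ U) (c : ℂ) :
    b.germ hb (constHom π U c) = b.const c := by
  simp only [constHom, RingHom.comp_apply, CPoint.const]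
  exact germ_map π (homOfLE le_top : U ⟶ ⊤) hb _

theorem ev_const (b : CPoint π) (c : ℂ) : b.ev (b.const c) = c := by
  have h := Scheme.germ_stalkClosedPointTo b.hom ⊤ trivial
  have h1 : b.ev (b.const c) = ((B.presheaf.germ ⊤ _ trivial ≫ Scheme.stalkClosedPointTo b.hom).hom
      (π.appTop.hom ((Scheme.ΓSpecIso (.of ℂ)).inv.hom c))) := rfl
  rw [h1, h]
  have h2 : π.appTop ≫ b.hom.appTop = 𝟙 _ := by
    rw [← Scheme.Hom.comp_appTop, b.isSection]; simp
  have h3 : ((Scheme.ΓSpecIso (.of ℂ)).inv ≫ (π.appTop ≫ b.hom.appTop) ≫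
      (Scheme.ΓSpecIso (.of ℂ)).hom).hom c = c := by
    rw [h2]; simp
  refine Eq.trans ?_ h3
  simp [Scheme.Hom.appTop]
  rfl

/-- All nonempty affine open subsets share the function field, hence have the same dimension; they
cover `B`. -/
theorem topologicalKrullDim_eq_ringKrullDim [IsIntegral B] [LocallyOfFiniteType π] {U : B.Opens}
    (hU : IsAffineOpen U) (hne : (U : Set B).Nonempty) :
    topologicalKrullDim B = ringKrullDim Γ(B, U) := by
  refine topologicalKrullDim_eq_of_forall_exists_open fun x => ?_
  obtain ⟨_, ⟨V : B.Opens, hV, rfl⟩, hxV, -⟩ :=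
    B.isBasis_affineOpens.exists_subset_of_mem_open (Set.mem_univ x) isOpen_univ
  refine ⟨V, hxV, hV.topologicalKrullDim_eq.trans ?_⟩
  have : Nonempty U := hne.to_subtype
  have : Nonempty V := ⟨⟨x, hxV⟩⟩
  let := (constHom π U).toAlgebra
  let := (constHom π V).toAlgebra
  let := ((B.germToFunctionField U).hom.comp (constHom π U)).toAlgebra
  have : Algebra.FiniteType ℂ Γ(B, U) := finiteType_constHom π hU
  have : Algebra.FiniteType ℂ Γ(B, V) := finiteType_constHom π hV
  have : IsScalarTower ℂ Γ(B, U) B.functionField := .of_algebraMap_eq' rfl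
  have : IsScalarTower ℂ Γ(B, V) B.functionField := by
    refine .of_algebraMap_eq fun c => ?_
    change B.germToFunctionField U (constHom π U c) = B.germToFunctionField V (constHom π V c)
    rw [← map_constHom π (homOfLE le_top : U ⟶ ⊤), ← map_constHom π (homOfLE le_top : V ⟶ ⊤)]
    exact (TopCat.Presheaf.germ_res_apply B.presheaf _ _ _ _).trans
      (TopCat.Presheaf.germ_res_apply B.presheaf _ _ _ _).symm
  have := functionField_isFractionRing_of_isAffineOpen B U hU
  have := functionField_isFractionRing_of_isAffineOpen B V hV
  exact ringKrullDim_eq_of_isFractionRing (K := B.functionField)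

theorem exists_cpoint_mem [LocallyOfFiniteType π] {U : B.Opens} (hne : (U : Set B).Nonempty) :
    ∃ b : CPoint π, b.pt ∈ U := by
  have := LocallyOfFiniteType.jacobsonSpace π
  obtain ⟨x, hxU, hx⟩ := nonempty_inter_closedPoints hne U.isOpen.isLocallyClosed
  exact ⟨⟨pointOfClosedPoint π x hx, pointOfClosedPoint_comp π x hx⟩, by
    have h : pointOfClosedPoint π x hx (IsLocalRing.closedPoint ℂ) = x :=
      pointOfClosedPoint_apply π x hx _
    change pointOfClosedPoint π x hx (IsLocalRing.closedPoint ℂ) ∈ U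
    rwa [h]⟩

variable {π}

theorem CPoint.isUnit_of_ev_ne_zero (b : CPoint π) {z : b.LocalRing} (hz : b.ev z ≠ 0) :
    IsUnit z :=
  (Scheme.isLocalHom_stalkClosedPointTo' b.hom).map_nonunit z (isUnit_iff_ne_zero.mpr hz)

theorem CPoint.value_ne_zero_iff (b : CPoint π) {U : B.Opens} (hb : b.pt ∈ U) (f : Γ(B, U)) :
    b.value hb f ≠ 0 ↔ b.pt ∈ B.basicOpen f := by
  rw [Scheme.mem_basicOpen _ _ _ hb]
  exact ⟨fun h => b.isUnit_of_ev_ne_zero h, fun h => (h.map b.ev).ne_zero⟩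

/-- On an integral scheme a nonzero function has a nonempty basic open set, and this contains a
complex point. Identities between functions can thus be checked pointwise. -/
theorem eq_zero_of_forall_value_eq_zero [IsIntegral B] [LocallyOfFiniteType π] {U : B.Opens}
    {f : Γ(B, U)} (h : ∀ (b : CPoint π) (hb : b.pt ∈ U), b.value hb f = 0) : f = 0 := by
  rw [← basicOpen_eq_bot_iff, ← TopologicalSpace.Opens.not_nonempty_iff_eq_bot]
  intro hne
  obtain ⟨b, hb⟩ := exists_cpoint_mem π hne
  have hbU := B.basicOpen_le f hb
  exact (b.value_ne_zero_iff hbU f).mpr hb (h b hbU)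

end Dimension

/-! ### Tangent vectors and frames of vector fields. -/

section Tangent

variable {B : Scheme.{0}} {π : B ⟶ Spec (.of ℂ)}

namespace CPoint

theorem tangentSpace_map_add (b : CPoint π) (D : b.tangentSpace) (f g : b.LocalRing) :
    D.1 (f + g) = D.1 f + D.1 g := D.2.1 f g

theorem tangentSpace_map_mul (b : CPoint π) (D : b.tangentSpace) (f g : b.LocalRing) :
    D.1 (f * g) = b.ev f * D.1 g + b.ev g * D.1 f := D.2.2.1 f g

theorem tangentSpace_map_const (b : CPoint π) (D : b.tangentSpace) (c : ℂ) :
    D.1 (b.const c) = 0 := D.2.2.2 c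

theorem tangentSpace_map_zero (b : CPoint π) (D : b.tangentSpace) : D.1 0 = 0 := by
  simpa using b.tangentSpace_map_add D 0 0

theorem tangentSpace_map_sum (b : CPoint π) (D : b.tangentSpace) {ι : Type*} (s : Finset ι)
    (f : ι → b.LocalRing) : D.1 (∑ i ∈ s, f i) = ∑ i ∈ s, D.1 (f i) :=
  map_sum (⟨⟨D.1, b.tangentSpace_map_zero D⟩, b.tangentSpace_map_add D⟩ : b.LocalRing →+ ℂ) f s

/-- The stalk at a point of an affine open subset is a localization of its functions. -/
theorem exists_mul_germ_eq (b : CPoint π) {U : B.Opens} (hU : IsAffineOpen U) (hb : b.pt ∈ U)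
    (z : b.LocalRing) :
    ∃ f s : Γ(B, U), IsUnit (b.germ hb s) ∧ z * b.germ hb s = b.germ hb f := by
  let x : U := ⟨b.pt, hb⟩
  let : Algebra Γ(B, U) b.LocalRing := TopCat.Presheaf.algebra_section_stalk B.presheaf x
  have h : IsLocalization.AtPrime b.LocalRing (hU.primeIdealOf x).asIdeal :=
    hU.isLocalization_stalk x
  obtain ⟨⟨f, s⟩, hfs⟩ := IsLocalization.surj (hU.primeIdealOf x).asIdeal.primeCompl z
  exact ⟨f, s, IsLocalization.map_units b.LocalRing s, hfs⟩

/-- A tangent vector is determined by the derivatives of the functions on an affine neighbourhood. -/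
theorem tangentSpace_ext (b : CPoint π) {U : B.Opens} (hU : IsAffineOpen U) (hb : b.pt ∈ U)
    {D E : b.tangentSpace} (h : ∀ f, D.1 (b.germ hb f) = E.1 (b.germ hb f)) : D = E := by
  ext z
  obtain ⟨f, s, hs, hz⟩ := b.exists_mul_germ_eq hU hb z
  have h1 := h f
  rw [← hz, tangentSpace_map_mul, tangentSpace_map_mul, h s] at h1
  exact mul_left_cancel₀ (hs.map b.ev).ne_zero (add_left_cancel h1)

/-- A derivation of the ring of functions on an affine neighbourhood, with values at the point,
extends to a tangent vector. -/
theorem exists_tangentVector (b : CPoint π) {U : B.Opens} (hU : IsAffineOpen U) (hb : b.pt ∈ U)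
    (δ : Γ(B, U) → ℂ) (hadd : ∀ f g, δ (f + g) = δ f + δ g)
    (hmul : ∀ f g, δ (f * g) = b.value hb f * δ g + b.value hb g * δ f)
    (hconst : ∀ c, δ (constHom π U c) = 0) :
    ∃ D : b.tangentSpace, ∀ f, D.1 (b.germ hb f) = δ f := by
  let x : U := ⟨b.pt, hb⟩
  have hone : δ 1 = 0 := by simpa using hconst 1
  have hzero : δ 0 = 0 := by simpa using hadd 0 0
  -- A derivation at `b` is a ring homomorphism to the dual numbers lifting evaluation; in this form
  -- it extends to the stalk by the universal property of localization.
  let φ : Γ(B, U) →+* TrivSqZeroExt ℂ ℂ :=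
    { toFun f := TrivSqZeroExt.inl (b.value hb f) + TrivSqZeroExt.inr (δ f)
      map_one' := by simp [hone]
      map_zero' := by simp [hzero]
      map_add' f g := by ext <;> simp [hadd]
      map_mul' f g := by ext <;> simp [hmul]; ring }
  let : Algebra Γ(B, U) b.LocalRing := TopCat.Presheaf.algebra_section_stalk B.presheaf x
  have h : IsLocalization.AtPrime b.LocalRing (hU.primeIdealOf x).asIdeal :=
    hU.isLocalization_stalk x
  have hu : ∀ s : (hU.primeIdealOf x).asIdeal.primeCompl, IsUnit (φ s) := fun s => by
    rw [TrivSqZeroExt.isUnit_iff_isUnit_fst]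
    have : IsUnit (b.germ hb s) := IsLocalization.map_units b.LocalRing s
    simpa [φ, CPoint.value] using (this.map b.ev).ne_zero
  let Φ : b.LocalRing →+* TrivSqZeroExt ℂ ℂ := IsLocalization.lift (M := (hU.primeIdealOf x).asIdeal.primeCompl) hu
  have hΦ : ∀ f, Φ (b.germ hb f) = φ f := fun f => IsLocalization.lift_eq hu f
  have hfst : ∀ z, (Φ z).fst = b.ev z := fun z => by
    obtain ⟨f, s, hs, hz⟩ := b.exists_mul_germ_eq hU hb z
    have h1 := congrArg TrivSqZeroExt.fst (congrArg Φ hz)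
    rw [map_mul, hΦ, hΦ, TrivSqZeroExt.fst_mul] at h1
    have h2 := congrArg b.ev hz
    rw [map_mul] at h2
    refine mul_right_cancel₀ (hs.map b.ev).ne_zero ?_
    rw [h2]
    simpa [φ, CPoint.value] using h1
  refine ⟨⟨fun z => (Φ z).snd, fun f g => by simp, fun f g => by
      simp [hfst, mul_comm (TrivSqZeroExt.snd _)],
    fun c => ?_⟩,
    fun f => by simp [hΦ, φ]⟩
  change (Φ _).snd = 0
  rw [← germ_constHom π b hb, hΦ]
  simp [φ, hconst]

end CPoint

/-- Over a nonempty affine open subset contained in a given one, the variety has a frame of vector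
fields, and the number of its members is the dimension. -/
theorem exists_tangentFrame (π : B ⟶ Spec (.of ℂ)) [IsIntegral B] [LocallyOfFiniteType π]
    {V : B.Opens} (hV : (V : Set B).Nonempty) :
    ∃ (U : B.Opens) (n : ℕ) (δ : Fin n → Γ(B, U) → Γ(B, U)), (U : Set B).Nonempty ∧ U ≤ V ∧
      topologicalKrullDim B = n ∧ ∀ (b : CPoint π) (hb : b.pt ∈ U),
        ∃ e : Module.Basis (Fin n) ℂ b.tangentSpace,
          ∀ a f, (e a).1 (b.germ hb f) = b.value hb (δ a f) := by
  obtain ⟨x, hx⟩ := hV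
  obtain ⟨_, ⟨W : B.Opens, hW, rfl⟩, hxW, hWV⟩ :=
    B.isBasis_affineOpens.exists_subset_of_mem_open hx V.isOpen
  have hne : (W : Set B).Nonempty := ⟨x, hxW⟩
  have : Nonempty W := ⟨⟨x, hxW⟩⟩
  let := (constHom π W).toAlgebra
  have : Algebra.FiniteType ℂ Γ(B, W) := finiteType_constHom π hW
  obtain ⟨n, f, hf, hdim, -, h⟩ := exists_etale_coordinates Γ(B, W)
  let U := B.basicOpen f
  have hU : IsAffineOpen U := IsAffineOpen.basicOpen hW f
  let := (constHom π U).toAlgebra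
  have hloc : IsLocalization.Away f Γ(B, U) := IsAffineOpen.isLocalization_basicOpen hW f
  have : IsScalarTower ℂ Γ(B, W) Γ(B, U) :=
    .of_algebraMap_eq fun c => (map_constHom π (homOfLE (B.basicOpen_le f)) c).symm
  obtain ⟨x, δ, hδ, hD⟩ := h Γ(B, U)
  refine ⟨U, n, fun a => δ a, ?_, (B.basicOpen_le f).trans hWV, ?_, fun b hb => ?_⟩
  · rw [← not_not (a := Set.Nonempty _), TopologicalSpace.Opens.not_nonempty_iff_eq_bot,
      basicOpen_eq_bot_iff]
    exact hf
  · rw [topologicalKrullDim_eq_ringKrullDim π hW hne, hdim]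
  · have hvc : ∀ c, b.value hb (constHom π U c) = c := fun c => by
      rw [CPoint.value, RingHom.comp_apply, germ_constHom, ev_const]
    have hex : ∀ a, ∃ D : b.tangentSpace, ∀ f, D.1 (b.germ hb f) = b.value hb (δ a f) := fun a =>
      b.exists_tangentVector hU hb _ (fun f g => by simp) (fun f g => by simp)
        fun c => by
          rw [show constHom π U c = algebraMap ℂ Γ(B, U) c from rfl, Derivation.map_algebraMap, map_zero]
    choose e he using hex
    have hexp : ∀ (D : b.tangentSpace), D = ∑ a, D.1 (b.germ hb (x a)) • e a := fun D => by
      refine b.tangentSpace_ext hU hb fun f => ?_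
      -- With ℂ as a module through evaluation at `b`, the tangent vector restricts to a derivation
      -- into ℂ, to which the expansion `hD` in étale coordinates applies.
      let := Module.compHom ℂ (b.value hb)
      have hsmul : ∀ (f : Γ(B, U)) (z : ℂ), f • z = b.value hb f * z := fun _ _ => rfl
      have : IsScalarTower ℂ Γ(B, U) ℂ := ⟨fun c f z => by
        rw [hsmul, hsmul, Algebra.smul_def, map_mul, smul_eq_mul, mul_assoc,
          show algebraMap ℂ Γ(B, U) c = constHom π U c from rfl, hvc]⟩
      let D' : Derivation ℂ Γ(B, U) ℂ := Derivation.mk'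
        { toFun f := D.1 (b.germ hb f)
          map_add' f g := by rw [map_add, b.tangentSpace_map_add]
          map_smul' c f := by
            rw [Algebra.smul_def, map_mul, b.tangentSpace_map_mul,
              show algebraMap ℂ Γ(B, U) c = constHom π U c from rfl, germ_constHom,
              b.tangentSpace_map_const, ev_const]
            simp }
        fun f g => by
          change D.1 (b.germ hb (f * g)) = _
          rw [map_mul, b.tangentSpace_map_mul]; rfl
      have h1 := hD ℂ D' f
      change D.1 (b.germ hb f) = _
      refine h1.trans ?_
      simp only [hsmul, Submodule.coe_sum, Finset.sum_apply, Submodule.coe_smul, Pi.smul_apply, he, smul_eq_mul]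
      exact Finset.sum_congr rfl fun a _ => mul_comm _ _
    have hli : LinearIndependent ℂ e := by
      rw [Fintype.linearIndependent_iff]
      intro g hg i
      have h1 := congrFun (congrArg Subtype.val hg) (b.germ hb (x i))
      simpa [he, hδ, Finset.sum_apply] using h1
    have hspan : ⊤ ≤ Submodule.span ℂ (Set.range e) := by
      rintro D -
      rw [hexp D]
      exact Submodule.sum_mem _ fun a _ => Submodule.smul_mem _ _ (Submodule.subset_span ⟨a, rfl⟩)
    exact ⟨Module.Basis.mk hli hspan, fun a f => by rw [Module.Basis.mk_apply, he]⟩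

end Tangent

/-! ### Forms, maximal minors and column spaces. -/

section LinearAlgebra

open MvPolynomial in
theorem MvPolynomial.isHomogeneous_det {σ R ν : Type*} [CommRing R] [Fintype ν] [DecidableEq ν]
    (M : Matrix ν ν (MvPolynomial σ R)) (w : ν → ℕ) (h : ∀ i j, (M i j).IsHomogeneous (w j)) :
    M.det.IsHomogeneous (∑ j, w j) := by
  rw [Matrix.det_apply]
  refine IsHomogeneous.sum _ _ _ fun τ _ => ?_
  have := IsHomogeneous.prod Finset.univ (fun j => M (τ j) j) w fun j _ => h _ _
  rcases Int.units_eq_one_or (Equiv.Perm.sign τ) with h | h <;> rw [h]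
  · simpa using this
  · simpa using this.neg

theorem MvPolynomial.le_of_dvd_of_isHomogeneous {σ R : Type*} [CommRing R] [IsDomain R]
    {p q : MvPolynomial σ R} {m n : ℕ} (hp : p.IsHomogeneous m) (hq : q.IsHomogeneous n)
    (hq0 : q ≠ 0) (h : p ∣ q) : m ≤ n := by
  obtain ⟨s, rfl⟩ := h
  have hp0 := left_ne_zero_of_mul hq0
  have hs0 := right_ne_zero_of_mul hq0
  rw [← hp.totalDegree hp0, ← hq.totalDegree hq0, totalDegree_mul_of_isDomain hp0 hs0]
  exact Nat.le_add_right _ _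

theorem MvPolynomial.exists_eq_C_mul_of_dvd {σ R : Type*} [CommRing R] [IsDomain R]
    {p q : MvPolynomial σ R} {n : ℕ} (hp : p.IsHomogeneous n) (hq : q.IsHomogeneous n)
    (h : p ∣ q) : ∃ t, q = C t * p := by
  by_cases hq0 : q = 0
  · exact ⟨0, by simp [hq0]⟩
  obtain ⟨s, rfl⟩ := h
  have hp0 := left_ne_zero_of_mul hq0
  have hs0 := right_ne_zero_of_mul hq0
  have h1 := totalDegree_mul_of_isDomain hp0 hs0
  rw [hq.totalDegree hq0, hp.totalDegree hp0] at h1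
  obtain ⟨t, rfl⟩ : ∃ t, s = C t := ⟨_, totalDegree_eq_zero_iff_eq_C.mp (by omega)⟩
  exact ⟨t, mul_comm _ _⟩

theorem MvPolynomial.exists_ne_zero_eval_ne_zero {n : ℕ} {p : MvPolynomial (Fin (n + 1)) ℂ}
    (hp : p ≠ 0) : ∃ c, c ≠ 0 ∧ eval c p ≠ 0 := by
  by_contra! h
  -- The factor `X 0` takes care of the origin, where `p` may be nonzero.
  have h1 : p * X 0 = 0 := MvPolynomial.funext fun c => by
    by_cases hc : c = 0
    · simp [hc]
    · simp [h c hc]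
  exact hp ((mul_eq_zero.mp h1).resolve_right (X_ne_zero 0))

namespace Matrix

variable {K ι κ Λ : Type*} [Field K] [Fintype κ] [DecidableEq κ]

/-- The maximal minors of a family of matrices, as a vector, do not change their direction. -/
def ProportionalMinors (M : Λ → Matrix ι κ K) : Prop :=
  ∀ (r r' : κ → ι) (c c' : Λ), ((M c).submatrix r id).det * ((M c').submatrix r' id).det =
    ((M c).submatrix r' id).det * ((M c').submatrix r id).det

/-- Cramer's rule. It turns the columns of `M`, recombined by an adjugate, into vectors of maximal
minors. -/
theorem mul_adjugate_submatrix_apply (M : Matrix ι κ K) (r : κ → ι) (j : ι) (i : κ) :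
    (M * (M.submatrix r id).adjugate) j i =
      (M.submatrix (Function.update r i j) id).det := by
  have h : (M.submatrix r id).updateRow i (M j) = M.submatrix (Function.update r i j) id := by
    ext a l
    by_cases ha : a = i
    · subst ha; simp
    · simp [ha]
  rw [← h, ← cramer_transpose_apply, cramer_eq_adjugate_mulVec, ← adjugate_transpose,
    mulVec_transpose]
  rfl

/-- Plücker coordinates determine the column space: `M` and `M'`, each times the adjugate of its
`r`-block, have entries that are maximal minors, so they agree up to a nonzero scalar, and the
adjugates are invertible. -/
theorem range_mulVecLin_le_of_minors {M M' : Matrix ι κ K} {r : κ → ι}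
    (h : (M.submatrix r id).det ≠ 0) (h' : (M'.submatrix r id).det ≠ 0)
    (hr : ∀ r', (M.submatrix r' id).det * (M'.submatrix r id).det =
      (M.submatrix r id).det * (M'.submatrix r' id).det) :
    LinearMap.range M.mulVecLin ≤ LinearMap.range M'.mulVecLin := by
  have h1 : (M'.submatrix r id).det • (M * (M.submatrix r id).adjugate) =
      (M.submatrix r id).det • (M' * (M'.submatrix r id).adjugate) := by
    ext j i
    simp only [smul_apply, mul_adjugate_submatrix_apply, smul_eq_mul]
    rw [mul_comm, hr]
  have h2 : M * (((M'.submatrix r id).det * (M.submatrix r id).det) • (1 : Matrix κ κ K)) =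
      M' * ((M.submatrix r id).det • ((M'.submatrix r id).adjugate * M.submatrix r id)) := by
    have h3 := congrArg (· * M.submatrix r id) h1
    simp only [smul_mul, Matrix.mul_assoc, adjugate_mul] at h3
    rw [Matrix.mul_smul, ← smul_smul, ← Matrix.mul_smul, h3, Matrix.mul_smul]
  rintro _ ⟨v, rfl⟩
  refine ⟨((M'.submatrix r id).det * (M.submatrix r id).det)⁻¹ •
    (((M.submatrix r id).det • ((M'.submatrix r id).adjugate * M.submatrix r id)) *ᵥ v), ?_⟩
  rw [mulVecLin_apply, mulVecLin_apply, mulVec_smul, mulVec_mulVec, ← h2, ← mulVec_mulVec,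
    smul_mulVec, one_mulVec, mulVec_smul, inv_smul_smul₀ (mul_ne_zero h' h)]

theorem range_mulVecLin_eq_of_proportionalMinors {M : Λ → Matrix ι κ K}
    (hM : ProportionalMinors M) {r : κ → ι} {c c' : Λ} (h : ((M c).submatrix r id).det ≠ 0)
    (h' : ((M c').submatrix r id).det ≠ 0) :
    LinearMap.range (M c).mulVecLin = LinearMap.range (M c').mulVecLin :=
  le_antisymm (range_mulVecLin_le_of_minors h h' fun r' => hM r' r c c')
    (range_mulVecLin_le_of_minors h' h fun r' => hM r' r c' c)

/-- All maximal minors at `c` acquire the same factor `(A c).det`, so the cross relations persist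
even if `A c` is singular. -/
theorem ProportionalMinors.of_mul {M M' : Λ → Matrix ι κ K} (hM : ProportionalMinors M)
    (g : Λ → Λ) (A : Λ → Matrix κ κ K) (h : ∀ c, M' c = M (g c) * A c) :
    ProportionalMinors M' := by
  have key : ∀ (r : κ → ι) c, ((M' c).submatrix r id).det =
      ((M (g c)).submatrix r id).det * (A c).det := fun r c => by
    rw [h, ← det_mul, submatrix_mul _ _ r id id Function.bijective_id, submatrix_id_id]
  intro r r' c c'
  rw [key, key, key, key]
  linear_combination (A c).det * (A c').det * hM r r' (g c) (g c')

/-- A matrix with linearly independent rows has a right inverse. -/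
theorem exists_mul_eq_one_of_linearIndependent [Fintype ι] [DecidableEq ι] {M : Matrix κ ι K}
    (h : LinearIndependent K M) : ∃ L : Matrix ι κ K, M * L = 1 := by
  have hinj : LinearMap.ker Mᵀ.mulVecLin = ⊥ := by
    rw [ker_mulVecLin_eq_bot_iff]
    intro v hv
    rw [mulVec_transpose] at hv
    exact (Matrix.vecMul_injective_iff.mpr h) (hv.trans (zero_vecMul M).symm)
  obtain ⟨L, hL⟩ := LinearMap.exists_leftInverse_of_injective _ hinj
  refine ⟨(LinearMap.toMatrix' L)ᵀ, ?_⟩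
  have := congrArg LinearMap.toMatrix' hL
  rw [LinearMap.toMatrix'_comp, ← Matrix.toLin'_apply', LinearMap.toMatrix'_toLin', LinearMap.toMatrix'_id] at this
  rw [← transpose_inj, transpose_mul, transpose_transpose, this, transpose_one]

end Matrix

end LinearAlgebra

/-! ### Homogeneous coordinates and the topology of a fibre. -/

section Fibre

variable {B : Scheme.{0}} {π : B ⟶ Spec (.of ℂ)} {k N m : ℕ}

/-- The values at `b` of the members of a frame. -/
noncomputable def LocalFrame.vec {W : CPoint π → Submodule ℂ (Fin (N + 1) → ℂ)} (φ : LocalFrame π k N W)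
    {b : CPoint π} (hb : b.pt ∈ φ.U) (i : Fin (k + 1)) : Fin (N + 1) → ℂ :=
  fun j => b.value hb (φ.s i j)

/-- The derivative of the spreading map at `(b, c)`, as a matrix with respect to a frame and to
tangent vectors `D`. -/
noncomputable def LocalFrame.matrix {W : CPoint π → Submodule ℂ (Fin (N + 1) → ℂ)} (φ : LocalFrame π k N W)
    {b : CPoint π} (hb : b.pt ∈ φ.U) (D : Fin m → b.tangentSpace) (c : Fin (k + 1) → ℂ) :
    Matrix (Fin (N + 1)) (Fin (k + 1) ⊕ Fin m) ℂ :=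
  Matrix.of fun j => Sum.elim (fun i => φ.vec hb i j)
    fun a => ∑ i, c i * (D a).1 (b.germ hb (φ.s i j))

theorem LocalFrame.exists_vec_eq {W : CPoint π → Submodule ℂ (Fin (N + 1) → ℂ)}
    (φ ψ : LocalFrame π k N W) {b : CPoint π} (hb : b.pt ∈ φ.U) (hb' : b.pt ∈ ψ.U) :
    ∃ G : Matrix (Fin (k + 1)) (Fin (k + 1)) ℂ, ∀ i, φ.vec hb i = ∑ l, G i l • ψ.vec hb' l := by
  have h : ∀ i, ∃ g : Fin (k + 1) → ℂ, ∑ l, g l • ψ.vec hb' l = φ.vec hb i := fun i => by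
    rw [← Submodule.mem_span_range_iff_exists_fun]
    have h1 : φ.vec hb i ∈ W b := by
      rw [← φ.span_eq b hb]
      exact Submodule.subset_span ⟨i, rfl⟩
    rwa [← ψ.span_eq b hb'] at h1
  choose G hG using h
  exact ⟨G, fun i => (hG i).symm⟩

namespace ParametricScroll

variable (S : ParametricScroll π k N)

theorem linearIndependent_frameVec (b : CPoint π) : LinearIndependent ℂ (S.frameVec b) :=
  (S.frame b).linearIndependent b (S.mem_frame b)

theorem span_frameVec (b : CPoint π) : Submodule.span ℂ (Set.range (S.frameVec b)) = S.W b :=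
  (S.frame b).span_eq b (S.mem_frame b)

theorem sum_smul_frameVec_ne_zero (b : CPoint π) {c : Fin (k + 1) → ℂ} (hc : c ≠ 0) :
    ∑ i, c i • S.frameVec b i ≠ 0 := fun h =>
  hc (funext (Fintype.linearIndependent_iff.mp (S.linearIndependent_frameVec b) c h))

variable {S}

theorem exists_isFibreCoord {b : CPoint π} (x : S.Fibre b) :
    ∃ c, S.IsFibreCoord x c := by
  obtain ⟨⟨b, p, hp⟩, rfl⟩ := x
  have h : p.rep ∈ S.W b := hp (by rw [Projectivization.submodule_eq]; exact Submodule.mem_span_singleton_self _)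
  rw [← S.span_frameVec b, Submodule.mem_span_range_iff_exists_fun] at h
  obtain ⟨c, hc⟩ := h
  refine ⟨c, ?_⟩
  rw [IsFibreCoord, hc]
  exact p.submodule_eq.symm

theorem exists_fibre_of_ne_zero (b : CPoint π) {c : Fin (k + 1) → ℂ} (hc : c ≠ 0) :
    ∃ x : S.Fibre b, S.IsFibreCoord x c := by
  have h := S.sum_smul_frameVec_ne_zero b hc
  refine ⟨⟨⟨b, Projectivization.mk ℂ _ h, ?_⟩, rfl⟩, ?_⟩
  · rw [Projectivization.submodule_mk, Submodule.span_singleton_le_iff_mem, ← S.span_frameVec b]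
    exact Submodule.sum_mem _ fun i _ => Submodule.smul_mem _ _ (Submodule.subset_span ⟨i, rfl⟩)
  · exact (Projectivization.submodule_mk _ h).symm

theorem IsFibreCoord.ne_zero {b : CPoint π} {x : S.Fibre b} {c : Fin (k + 1) → ℂ}
    (h : S.IsFibreCoord x c) : c ≠ 0 := by
  rintro rfl
  have h1 : Module.finrank ℂ x.1.point.submodule = 1 := x.1.point.finrank_submodule
  have h2 : ∑ i, (0 : Fin (k + 1) → ℂ) i • S.frameVec b i = 0 :=
    Finset.sum_eq_zero fun i _ => zero_smul ℂ _
  rw [← show Submodule.span ℂ {_} = _ from h, h2, Submodule.span_zero_singleton, finrank_bot] at h1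
  exact zero_ne_one h1

/-- Homogeneous coordinates are unique up to a scalar. -/
theorem IsFibreCoord.exists_smul_eq {b : CPoint π} {x : S.Fibre b} {c c' : Fin (k + 1) → ℂ}
    (h : S.IsFibreCoord x c) (h' : S.IsFibreCoord x c') : ∃ t : ℂ, t ≠ 0 ∧ c' = t • c := by
  have h1 : Submodule.span ℂ {_} = Submodule.span ℂ {_} :=
    (show Submodule.span ℂ {_} = _ from h).trans (show Submodule.span ℂ {_} = _ from h').symm
  rw [Submodule.span_singleton_eq_span_singleton] at h1
  obtain ⟨t, ht⟩ := h1
  refine ⟨t, t.ne_zero, ?_⟩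
  have h2 := Fintype.linearIndependent_iff.mp (S.linearIndependent_frameVec b) (c' - (t : ℂ) • c) (by
    simp only [Pi.sub_apply, sub_smul, Finset.sum_sub_distrib, ← ht, Pi.smul_apply, smul_assoc, ← Finset.smul_sum]
    rw [Units.smul_def, sub_self])
  exact sub_eq_zero.mp (funext h2)

end ParametricScroll

theorem MvPolynomial.IsHomogeneous.eval_smul {σ R : Type*} [CommSemiring R]
    {p : MvPolynomial σ R} {d : ℕ} (hp : p.IsHomogeneous d) (t : R) (c : σ → R) :
    eval (t • c) p = t ^ d * eval c p := by
  rw [eval_eq, eval_eq, Finset.mul_sum]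
  refine Finset.sum_congr rfl fun e he => ?_
  have h : e.sum (fun _ n => n) = d := by
    have := hp (mem_support_iff.mp he)
    rwa [Finsupp.weight_apply, Finsupp.sum_congr (g2 := fun _ n => n) (by simp)] at this
  simp only [Pi.smul_apply, smul_eq_mul, mul_pow, Finset.prod_mul_distrib,
    Finset.prod_pow_eq_pow_sum]
  rw [show ∑ i ∈ e.support, e i = d from h]
  ring

namespace ParametricScroll

variable {S : ParametricScroll π k N}

open MvPolynomial

/-- The points of a fibre at which a form does not vanish. -/
def fibreBasicOpen (S : ParametricScroll π k N) (b : CPoint π) (q : MvPolynomial (Fin (k + 1)) ℂ) :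
    Set (S.Fibre b) :=
  {x | ∃ c, S.IsFibreCoord x c ∧ eval c q ≠ 0}

theorem eval_ne_zero_of_mem_fibreBasicOpen {b : CPoint π} {q : MvPolynomial (Fin (k + 1)) ℂ}
    {d : ℕ} (hq : q.IsHomogeneous d) {x : S.Fibre b} (hx : x ∈ S.fibreBasicOpen b q)
    {c : Fin (k + 1) → ℂ} (hc : S.IsFibreCoord x c) : eval c q ≠ 0 := by
  obtain ⟨c', hc', h⟩ := hx
  obtain ⟨t, ht, rfl⟩ := hc'.exists_smul_eq hc
  rw [hq.eval_smul]
  exact mul_ne_zero (pow_ne_zero _ ht) h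

theorem isOpen_fibreBasicOpen {b : CPoint π} {q : MvPolynomial (Fin (k + 1)) ℂ} {d : ℕ}
    (hq : q.IsHomogeneous d) : IsOpen (S.fibreBasicOpen b q) := by
  rw [isOpen_induced_iff]
  let φ := S.frame b
  have hb : b.pt ∈ φ.U := S.mem_frame b
  -- The form is spread over the domain of the frame with constant coefficients.
  refine ⟨_, TopologicalSpace.isOpen_generateFrom_of_mem
    ⟨φ, d, map (constHom π φ.U) q, hq.map _, rfl⟩, ?_⟩
  have key : ∀ c, eval₂ (b.value hb) c (map (constHom π φ.U) q) = eval c q := fun c => by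
    have : (b.value hb).comp (constHom π φ.U) = RingHom.id ℂ := by
      ext z
      rw [RingHom.comp_apply, CPoint.value, RingHom.comp_apply, germ_constHom, ev_const]
      rfl
    rw [eval₂_map, this]
    rfl
  have hsum : ∀ c : Fin (k + 1) → ℂ, (fun j : Fin (N + 1) => ∑ i, c i * b.value hb (φ.s i j)) =
      ∑ i, c i • S.frameVec b i := fun c => by
    ext j
    simp [frameVec, φ]
  ext ⟨⟨b', p, hp⟩, hbb'⟩
  obtain rfl : b' = b := hbb'
  constructor
  · rintro ⟨hx, c, hc, h⟩
    refine ⟨c, ?_, (key c) ▸ h⟩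
    rw [IsFibreCoord, ← hsum]
    exact hc
  · rintro ⟨c, hc, h⟩
    refine ⟨hb, c, ?_, (key c).symm ▸ h⟩
    rw [IsFibreCoord, ← hsum] at hc
    exact hc

/-- Every neighbourhood of a point of the fibre contains the nonvanishing locus of a polynomial
in the fibre coordinates. -/
theorem exists_polynomial_of_isOpen {b : CPoint π} {O : Set S.Total} (hO : IsOpen O)
    {x : S.Fibre b} (hx : x.1 ∈ O) : ∃ q : MvPolynomial (Fin (k + 1)) ℂ, q ≠ 0 ∧
      ∀ (y : S.Fibre b) (c : Fin (k + 1) → ℂ), S.IsFibreCoord y c → eval c q ≠ 0 → y.1 ∈ O := by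
  induction hO with
  | univ => exact ⟨1, one_ne_zero, fun _ _ _ _ => trivial⟩
  | inter O₁ O₂ _ _ ih₁ ih₂ =>
    obtain ⟨q₁, h₁, hq₁⟩ := ih₁ hx.1
    obtain ⟨q₂, h₂, hq₂⟩ := ih₂ hx.2
    refine ⟨q₁ * q₂, mul_ne_zero h₁ h₂, fun y c hc h => ?_⟩
    rw [map_mul, mul_ne_zero_iff] at h
    exact ⟨hq₁ y c hc h.1, hq₂ y c hc h.2⟩
  | sUnion 𝒪 _ ih =>
    obtain ⟨O, hO, hxO⟩ := hx
    obtain ⟨q, h, hq⟩ := ih O hO hxO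
    exact ⟨q, h, fun y c hc hqc => ⟨O, hO, hq y c hc hqc⟩⟩
  | basic V hV =>
    obtain ⟨φ, d, p, hp, rfl⟩ := hV
    obtain ⟨⟨b', P, hP⟩, hbb'⟩ := x
    obtain rfl : b' = b := hbb'
    obtain ⟨hb, c₀, hc₀, h₀⟩ := hx
    replace hb : b'.pt ∈ φ.U := hb
    obtain ⟨G, hG⟩ := (S.frame b').exists_vec_eq φ (S.mem_frame b') hb
    have hsum : ∀ c : Fin (k + 1) → ℂ, (fun j : Fin (N + 1) =>
        ∑ l, Matrix.vecMul c G l * b'.value hb (φ.s l j)) = ∑ i, c i • S.frameVec b' i := fun c => by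
      have h1 : ∀ i, S.frameVec b' i = ∑ l, G i l • φ.vec hb l := hG
      ext j
      simp only [h1, Finset.sum_apply, Pi.smul_apply, smul_eq_mul, Matrix.vecMul, dotProduct,
        Finset.sum_mul, Finset.mul_sum, LocalFrame.vec]
      rw [Finset.sum_comm]
      exact Finset.sum_congr rfl fun _ _ => Finset.sum_congr rfl fun _ _ => mul_assoc _ _ _
    let q : MvPolynomial (Fin (k + 1)) ℂ :=
      bind₁ (fun l => ∑ i, C (G i l) * X i) (map (b'.value hb) p)
    have hq : ∀ c, eval c q = eval₂ (b'.value hb) (Matrix.vecMul c G) p := fun c => by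
      have : (fun l => eval c (∑ i, C (G i l) * X i)) = Matrix.vecMul c G := by
        ext l
        simp [Matrix.vecMul, dotProduct, mul_comm]
      rw [show eval c q = eval₂Hom (RingHom.id ℂ) c q from rfl, eval₂Hom_bind₁]
      change eval (fun l => eval c (∑ i, C (G i l) * X i)) _ = _
      rw [this, MvPolynomial.eval_map]
    -- `q` is `p` rewritten in the coordinates of the chosen frame. It is nonzero because its value
    -- at coordinates of the given point is, up to a nonzero scalar, the value of `p` at `c₀`.
    refine ⟨q, fun hq0 => ?_, ?_⟩
    · obtain ⟨c, hc⟩ := exists_isFibreCoord (⟨⟨b', P, hP⟩, rfl⟩ : S.Fibre b')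
      have h1 : Submodule.span ℂ {_} = Submodule.span ℂ {_} :=
        (show Submodule.span ℂ {_} = _ from hc).trans
          (show Submodule.span ℂ {_} = _ from hc₀).symm
      rw [← hsum, Submodule.span_singleton_eq_span_singleton] at h1
      obtain ⟨t, ht⟩ := h1
      have hli : LinearIndependent ℂ (φ.vec hb) := φ.linearIndependent b' hb
      have h2 := Fintype.linearIndependent_iff.mp hli (c₀ - (t : ℂ) • Matrix.vecMul c G) (by
        ext j
        have := congrFun ht j
        rw [Units.smul_def] at this
        simp only [Pi.smul_apply, smul_eq_mul, Finset.mul_sum] at this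
        simp only [Pi.sub_apply, Pi.smul_apply, smul_eq_mul, Finset.sum_apply, LocalFrame.vec, sub_mul,
          Finset.sum_sub_distrib, mul_assoc, this, Pi.zero_apply]
        exact sub_self _)
      have h3 : c₀ = (t : ℂ) • Matrix.vecMul c G := sub_eq_zero.mp (funext h2)
      apply h₀
      change eval₂ (b'.value hb) c₀ p = 0
      have h4 := hq c
      rw [hq0, map_zero, eval₂_eq_eval_map] at h4
      rw [h3, eval₂_eq_eval_map, (hp.map _).eval_smul, ← h4, mul_zero]
    · rintro ⟨⟨b'', P', hP'⟩, hbb''⟩ c hc h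
      obtain rfl : b'' = b' := hbb''
      refine ⟨hb, Matrix.vecMul c G, ?_, (hq c) ▸ h⟩
      rw [IsFibreCoord, ← hsum] at hc
      exact hc

/-- The fibre is irreducible: a product of two nonzero polynomials is nonzero at some nonzero
coordinate vector. -/
theorem dense_fibreBasicOpen (b : CPoint π) {q : MvPolynomial (Fin (k + 1)) ℂ} (hq : q ≠ 0) :
    Dense (S.fibreBasicOpen b q) := by
  rw [dense_iff_inter_open]
  rintro _ hO' ⟨x, hx⟩
  obtain ⟨O, hO, rfl⟩ := isOpen_induced_iff.mp hO'
  obtain ⟨p, hp, h⟩ := exists_polynomial_of_isOpen hO hx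
  obtain ⟨c, hc, hpq⟩ := exists_ne_zero_eval_ne_zero (mul_ne_zero hp hq)
  rw [map_mul, mul_ne_zero_iff] at hpq
  obtain ⟨y, hy⟩ := S.exists_fibre_of_ne_zero b hc
  exact ⟨y, h y c hy hpq.1, c, hy, hpq.2⟩

theorem fibreBasicOpen_nonempty (b : CPoint π) {q : MvPolynomial (Fin (k + 1)) ℂ} (hq : q ≠ 0) :
    (S.fibreBasicOpen b q).Nonempty := by
  obtain ⟨c, hc, h⟩ := exists_ne_zero_eval_ne_zero hq
  obtain ⟨y, hy⟩ := S.exists_fibre_of_ne_zero b hc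
  exact ⟨y, c, hy, h⟩

end ParametricScroll

end Fibre

/-! ### The degree bound and stationarity on a single fibre. -/

section Fibrewise

variable {B : Scheme.{0}} {π : B ⟶ Spec (.of ℂ)} {k N m : ℕ}

namespace ParametricScroll

open MvPolynomial

variable (S : ParametricScroll π k N)

/-- The maximal minors of the derivative of the spreading map, as forms on a fibre. -/
noncomputable def minor (b : CPoint π) (D : Fin m → b.tangentSpace)
    (r : Fin (k + 1) ⊕ Fin m → Fin (N + 1)) : MvPolynomial (Fin (k + 1)) ℂ :=
  ((S.derivMatrix b D).submatrix r id).det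

/-- The derivative of the spreading map as a matrix with respect to the chosen frame. -/
noncomputable def fibreMatrix (b : CPoint π) (D : Fin m → b.tangentSpace) (c : Fin (k + 1) → ℂ) :
    Matrix (Fin (N + 1)) (Fin (k + 1) ⊕ Fin m) ℂ :=
  (S.frame b).matrix (S.mem_frame b) D c

variable {S} {b : CPoint π}

theorem eval_minor (D : Fin m → b.tangentSpace) (r : Fin (k + 1) ⊕ Fin m → Fin (N + 1))
    (c : Fin (k + 1) → ℂ) : eval c (S.minor b D r) = ((S.fibreMatrix b D c).submatrix r id).det := by
  rw [minor, RingHom.map_det]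
  congr 1
  ext i (j | j)
  · simp [derivMatrix, fibreMatrix, LocalFrame.matrix, LocalFrame.vec, frameVec]
  · simp [derivMatrix, fibreMatrix, LocalFrame.matrix, frameDeriv, mul_comm]

theorem isHomogeneous_minor (D : Fin m → b.tangentSpace)
    (r : Fin (k + 1) ⊕ Fin m → Fin (N + 1)) : (S.minor b D r).IsHomogeneous m := by
  have h := isHomogeneous_det ((S.derivMatrix b D).submatrix r id)
    (Sum.elim (fun _ => 0) fun _ => 1) (by
      rintro i (j | j)
      · exact isHomogeneous_C _ _
      · refine IsHomogeneous.sum Finset.univ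
          (fun l => C (S.frameDeriv b l (D j) (r i)) * X l) 1 fun l _ => ?_
        simpa using (isHomogeneous_C _ (S.frameDeriv b l (D j) (r i))).mul (isHomogeneous_X ℂ l))
  have hsum : ∑ j : Fin (k + 1) ⊕ Fin m, Sum.elim (fun _ => 0) (fun _ => 1) j = m := by simp
  rwa [hsum] at h

theorem focalIdeal_eq (hm : Module.finrank ℂ b.tangentSpace = m) : S.focalIdeal b =
    Ideal.span {p | ∃ (D : Fin m → b.tangentSpace) (r : Fin (k + 1) ⊕ Fin m → Fin (N + 1)),
      p = S.minor b D r} := by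
  subst hm
  rfl

theorem minor_mem_focalIdeal (e : Module.Basis (Fin m) ℂ b.tangentSpace)
    (r : Fin (k + 1) ⊕ Fin m → Fin (N + 1)) : S.minor b e r ∈ S.focalIdeal b := by
  rw [focalIdeal_eq (by rw [Module.finrank_eq_card_basis e, Fintype.card_fin])]
  exact Ideal.subset_span ⟨e, r, rfl⟩

/-- Expanding `D` in the basis `e` multiplies the matrix on the right by a square one. Hence the
minors for a single basis generate the focal ideal. -/
theorem minor_eq_mul (e : Module.Basis (Fin m) ℂ b.tangentSpace) (D : Fin m → b.tangentSpace)
    (r : Fin (k + 1) ⊕ Fin m → Fin (N + 1)) :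
    ∃ t, S.minor b D r = S.minor b e r * t := by
  let A : Matrix (Fin (k + 1) ⊕ Fin m) (Fin (k + 1) ⊕ Fin m) (MvPolynomial (Fin (k + 1)) ℂ) :=
    Matrix.fromBlocks 1 0 0 (Matrix.of fun a a' => C (e.repr (D a') a))
  have h : S.derivMatrix b D = S.derivMatrix b e * A := by
    ext1 j (i | a)
    · simp [derivMatrix, A, Matrix.mul_apply, Matrix.one_apply]
    · have h1 : ∀ i, S.frameDeriv b i (D a) = ∑ a', e.repr (D a) a' • S.frameDeriv b i (e a') :=
        fun i => by
          conv_lhs => rw [← e.sum_repr (D a), map_sum]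
          simp
      simp only [derivMatrix, A, Matrix.mul_apply, Matrix.of_apply, Sum.elim_inr, h1,
        Finset.sum_apply, Pi.smul_apply, smul_eq_mul, map_sum, map_mul, Fintype.sum_sum_type,
        Sum.elim_inl, Matrix.fromBlocks_apply₁₂, Matrix.fromBlocks_apply₂₂, Matrix.zero_apply,
        mul_zero, Finset.sum_const_zero, zero_add, Finset.sum_mul]
      rw [Finset.sum_comm]
      exact Finset.sum_congr rfl fun _ _ => Finset.sum_congr rfl fun _ _ => by ring
  refine ⟨A.det, ?_⟩
  rw [minor, minor, h, ← Matrix.det_mul, Matrix.submatrix_mul _ _ r id id Function.bijective_id,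
    Matrix.submatrix_id_id]

theorem focalIdeal_le (e : Module.Basis (Fin m) ℂ b.tangentSpace)
    {I : Ideal (MvPolynomial (Fin (k + 1)) ℂ)} (h : ∀ r, S.minor b e r ∈ I) :
    S.focalIdeal b ≤ I := by
  rw [focalIdeal_eq (by rw [Module.finrank_eq_card_basis e, Fintype.card_fin]), Ideal.span_le]
  rintro _ ⟨D, r, rfl⟩
  obtain ⟨t, ht⟩ := S.minor_eq_mul e D r
  rw [ht]
  exact I.mul_mem_right t (h r)

namespace IsFocalHypersurface

variable {d : ℕ} {g : MvPolynomial (Fin (k + 1)) ℂ}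

theorem exists_minor_ne_zero (h : S.IsFocalHypersurface b d g)
    (e : Module.Basis (Fin m) ℂ b.tangentSpace) : ∃ r, S.minor b e r ≠ 0 := by
  by_contra! h0
  -- If all minors vanished, the zero form would be a common divisor and would divide `g`.
  refine h.ne_zero (zero_dvd_iff.mp (h.dvd_of_le 0 (focalIdeal_le e fun r => ?_)))
  rw [h0]
  exact Ideal.zero_mem _

theorem dvd_minor (h : S.IsFocalHypersurface b d g) (e : Module.Basis (Fin m) ℂ b.tangentSpace)
    (r : Fin (k + 1) ⊕ Fin m → Fin (N + 1)) : g ∣ S.minor b e r :=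
  Ideal.mem_span_singleton.mp (h.le_span (minor_mem_focalIdeal e r))

/-- The degree of a focal hypersurface is at most the dimension of the tangent space. -/
theorem degree_le (h : S.IsFocalHypersurface b d g)
    (e : Module.Basis (Fin m) ℂ b.tangentSpace) : d ≤ m := by
  obtain ⟨r, hr⟩ := h.exists_minor_ne_zero e
  exact le_of_dvd_of_isHomogeneous h.homogeneous (isHomogeneous_minor _ _) hr (h.dvd_minor e r)

theorem proportionalMinors (h : S.IsFocalHypersurface b m g)
    (e : Module.Basis (Fin m) ℂ b.tangentSpace) :
    Matrix.ProportionalMinors (S.fibreMatrix b e) := by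
  have h1 : ∀ r, ∃ t, S.minor b e r = C t * g := fun r =>
    exists_eq_C_mul_of_dvd h.homogeneous (isHomogeneous_minor _ _) (h.dvd_minor e r)
  choose t ht using h1
  intro r r' c c'
  simp only [← eval_minor, ht, map_mul, eval_C]
  ring

end IsFocalHypersurface

theorem range_coneDeriv (e : Module.Basis (Fin m) ℂ b.tangentSpace) (c : Fin (k + 1) → ℂ) :
    LinearMap.range (S.coneDeriv b c) = LinearMap.range (S.fibreMatrix b e c).mulVecLin := by
  let E : (Fin (k + 1) ⊕ Fin m → ℂ) ≃ₗ[ℂ] (Fin (k + 1) → ℂ) × b.tangentSpace :=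
    (LinearEquiv.sumArrowLequivProdArrow _ _ ℂ ℂ).trans
      ((LinearEquiv.refl ℂ _).prodCongr e.equivFun.symm)
  have h : (S.fibreMatrix b e c).mulVecLin = S.coneDeriv b c ∘ₗ E.toLinearMap := by
    refine LinearMap.ext fun v => ?_
    ext j
    have h1 : E v = (fun i => v (.inl i), ∑ a, v (.inr a) • e a) := by
      simp [E, LinearEquiv.sumArrowLequivProdArrow, Equiv.sumArrowEquivProdArrow]
      rfl
    rw [LinearMap.comp_apply, LinearEquiv.coe_coe, h1]
    simp only [Matrix.mulVecLin_apply, Matrix.mulVec, dotProduct, Fintype.sum_sum_type,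
      fibreMatrix, LocalFrame.matrix, Matrix.of_apply, Sum.elim_inl, Sum.elim_inr, coneDeriv,
      LinearMap.coprod_apply, Pi.add_apply, LinearMap.sum_apply, LinearMap.smulRight_apply,
      LinearMap.proj_apply, Finset.sum_apply, Pi.smul_apply, smul_eq_mul, LinearMap.smul_apply,
      map_sum, map_smul]
    congr 1
    · exact Finset.sum_congr rfl fun i _ => mul_comm _ _
    · refine Finset.sum_congr rfl fun a _ => ?_
      rw [Finset.sum_mul, Finset.mul_sum]
      refine Finset.sum_congr rfl fun i _ => ?_
      simp only [frameDeriv, LinearMap.coe_mk, AddHom.coe_mk]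
      ring
  rw [h, LinearMap.range_comp_of_range_eq_top _ (LinearEquiv.range E)]

variable (S) in
/-- The scroll is stationary along the fibre over `b`. -/
def IsStationaryAt (b : CPoint π) : Prop :=
  ∃ V : Set (S.Fibre b), IsOpen V ∧ Dense V ∧
    ∃ T : Submodule ℂ (Fin (N + 1) → ℂ), ∀ x ∈ V, ∀ c, S.IsFibreCoord x c →
      LinearMap.range (S.coneDeriv b c) = T

theorem isStationaryAt_of_proportionalMinors (e : Module.Basis (Fin m) ℂ b.tangentSpace)
    (h : Matrix.ProportionalMinors (S.fibreMatrix b e))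
    {r : Fin (k + 1) ⊕ Fin m → Fin (N + 1)} (hr : S.minor b e r ≠ 0) : S.IsStationaryAt b := by
  obtain ⟨c₀, -, hc₀⟩ := exists_ne_zero_eval_ne_zero hr
  refine ⟨_, isOpen_fibreBasicOpen (isHomogeneous_minor e r), dense_fibreBasicOpen b hr,
    LinearMap.range (S.coneDeriv b c₀), fun x hx c hc => ?_⟩
  have h1 := eval_ne_zero_of_mem_fibreBasicOpen (isHomogeneous_minor e r) hx hc
  rw [eval_minor] at hc₀ h1
  rw [range_coneDeriv e, range_coneDeriv e]
  exact Matrix.range_mulVecLin_eq_of_proportionalMinors h h1 hc₀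

/-- A functional vanishing on T, applied to a derivative column, gives a linear form in the
coordinates that vanishes on a dense open set. The form is therefore zero, and so is each
coefficient: every derivative of a frame vector lies in T. -/
theorem IsStationaryAt.exists_forall_mem_range (h : S.IsStationaryAt b)
    (e : Module.Basis (Fin m) ℂ b.tangentSpace) :
    ∃ c₀, (∀ i, S.frameVec b i ∈ LinearMap.range (S.fibreMatrix b e c₀).mulVecLin) ∧
      ∀ i a, S.frameDeriv b i (e a) ∈ LinearMap.range (S.fibreMatrix b e c₀).mulVecLin := by
  obtain ⟨V, hV, hVd, T, hT⟩ := h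
  have hcone : ∀ {q : MvPolynomial (Fin (k + 1)) ℂ} {d : ℕ}, q.IsHomogeneous d → q ≠ 0 →
      ∃ c, eval c q ≠ 0 ∧ LinearMap.range (S.coneDeriv b c) = T := fun {q d} hq hq0 => by
    obtain ⟨x, ⟨c, hc, hqc⟩, hxV⟩ := hVd.inter_open_nonempty _ (isOpen_fibreBasicOpen hq)
      (fibreBasicOpen_nonempty (S := S) b hq0)
    exact ⟨c, hqc, hT x hxV c hc⟩
  obtain ⟨c₀, -, hc₀⟩ := hcone (isHomogeneous_one _ ℂ) one_ne_zero
  refine ⟨c₀, fun i => ?_, fun i a => ?_⟩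
  · rw [← range_coneDeriv]
    refine ⟨(Pi.single i 1, 0), ?_⟩
    simp [coneDeriv, Pi.single_apply]
  · rw [← range_coneDeriv, hc₀, ← Subspace.forall_mem_dualAnnihilator_apply_eq_zero_iff]
    intro l hl
    let q : MvPolynomial (Fin (k + 1)) ℂ := ∑ i, C (l (S.frameDeriv b i (e a))) * X i
    have hq : q.IsHomogeneous 1 := IsHomogeneous.sum _ _ _ fun i _ => by
      simpa using (isHomogeneous_C _ (l (S.frameDeriv b i (e a)))).mul (isHomogeneous_X ℂ i)
    have hq0 : q = 0 := by
      by_contra hq0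
      obtain ⟨c, hc, hcT⟩ := hcone hq hq0
      apply hc
      have h1 : S.coneDeriv b c (0, e a) ∈ T := hcT ▸ LinearMap.mem_range_self _ _
      have h2 := (Submodule.mem_dualAnnihilator l).mp hl _ h1
      simpa [q, coneDeriv, mul_comm] using h2
    have h3 := congrArg (eval (Pi.single i 1)) hq0
    simpa [q, Pi.single_apply] using h3

/-- A focal hypersurface of a stationary fibre has degree at least the dimension of the tangent
space. -/
theorem IsFocalHypersurface.le_degree {d : ℕ} {g : MvPolynomial (Fin (k + 1)) ℂ}
    (h : S.IsFocalHypersurface b d g) (e : Module.Basis (Fin m) ℂ b.tangentSpace)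
    (hS : S.IsStationaryAt b) : m ≤ d := by
  obtain ⟨c₀, hu, hw⟩ := hS.exists_forall_mem_range e
  choose u hu using hu
  choose w hw using hw
  -- `Q` expresses the frame and its derivatives through the columns of the matrix at `c₀`, which
  -- span the fixed image.
  let Q : Matrix (Fin (k + 1) ⊕ Fin m) (Fin (k + 1) ⊕ Fin m) (MvPolynomial (Fin (k + 1)) ℂ) :=
    Matrix.of fun l => Sum.elim (fun i => C (u i l)) fun a => ∑ i, C (w i a l) * X i
  have hQ : Q.det.IsHomogeneous m := by
    have h1 := isHomogeneous_det Q (Sum.elim (fun _ => 0) fun _ => 1) (by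
      rintro l (j | j)
      · exact isHomogeneous_C _ _
      · refine IsHomogeneous.sum Finset.univ (fun i => C (w i j l) * X i) 1 fun i _ => ?_
        simpa using (isHomogeneous_C _ (w i j l)).mul (isHomogeneous_X ℂ i))
    have hsum : ∑ j : Fin (k + 1) ⊕ Fin m, Sum.elim (fun _ => 0) (fun _ => 1) j = m := by simp
    rwa [hsum] at h1
  let M₀ : Matrix (Fin (N + 1)) (Fin (k + 1) ⊕ Fin m) (MvPolynomial (Fin (k + 1)) ℂ) :=
    (S.fibreMatrix b e c₀).map C
  have hM : S.derivMatrix b e = M₀ * Q := by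
    ext1 j (i | a)
    · simp only [derivMatrix, Matrix.of_apply, Sum.elim_inl, ← hu, Matrix.mul_apply, M₀, Q,
        Matrix.map_apply, Matrix.mulVecLin_apply, Matrix.mulVec, dotProduct, map_sum, map_mul]
    · simp only [derivMatrix, Matrix.of_apply, Sum.elim_inr, ← hw, Matrix.mul_apply, M₀, Q,
        Matrix.map_apply, Matrix.mulVecLin_apply, Matrix.mulVec, dotProduct, map_sum, map_mul,
        Finset.mul_sum, Finset.sum_mul]
      rw [Finset.sum_comm]
      exact Finset.sum_congr rfl fun _ _ => Finset.sum_congr rfl fun _ _ => mul_assoc _ _ _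
  refine le_of_dvd_of_isHomogeneous hQ h.homogeneous h.ne_zero
    (h.dvd_of_le _ (focalIdeal_le e fun r => Ideal.mem_span_singleton.mpr ?_))
  rw [minor, hM, Matrix.submatrix_mul _ _ r id id Function.bijective_id, Matrix.submatrix_id_id,
    Matrix.det_mul]
  exact dvd_mul_left _ _

end ParametricScroll

end Fibrewise

/-! ### Independence of the frame, and variation over the base. -/

section FrameChange

variable {B : Scheme.{0}} {π : B ⟶ Spec (.of ℂ)} {k N m : ℕ}

theorem CPoint.value_map {b : CPoint π} {U V : B.Opens} (i : V ⟶ U) (hb : b.pt ∈ V) (f : Γ(B, U)) :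
    b.value hb ((B.presheaf.map i.op).hom f) = b.value (i.le hb) f := by
  rw [CPoint.value, RingHom.comp_apply, germ_map]
  rfl

theorem CPoint.value_constHom (b : CPoint π) {U : B.Opens} (hb : b.pt ∈ U) (c : ℂ) :
    b.value hb (constHom π U c) = c := by
  rw [CPoint.value, RingHom.comp_apply, germ_constHom, ev_const]

namespace LocalFrame

variable {W : CPoint π → Submodule ℂ (Fin (N + 1) → ℂ)}

/-- The germs at `b` of two frames differ by an invertible matrix of germs. -/
theorem exists_germ_eq [IsIntegral B] [LocallyOfFiniteType π] (φ ψ : LocalFrame π k N W)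
    {b : CPoint π} (hb : b.pt ∈ φ.U) (hb' : b.pt ∈ ψ.U) :
    ∃ G : Matrix (Fin (k + 1)) (Fin (k + 1)) b.LocalRing,
      ∀ i j, b.germ hb (φ.s i j) = ∑ l, G i l * b.germ hb' (ψ.s l j) := by
  let V : B.Opens := φ.U ⊓ ψ.U
  have hbV : b.pt ∈ V := ⟨hb, hb'⟩
  let iφ : V ⟶ φ.U := homOfLE inf_le_left
  let iψ : V ⟶ ψ.U := homOfLE inf_le_right
  let P : Matrix (Fin (k + 1)) (Fin (N + 1)) Γ(B, V) :=
    Matrix.of fun i j => (B.presheaf.map iφ.op).hom (φ.s i j)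
  let Q : Matrix (Fin (k + 1)) (Fin (N + 1)) Γ(B, V) :=
    Matrix.of fun i j => (B.presheaf.map iψ.op).hom (ψ.s i j)
  have hP : ∀ (b : CPoint π) (h : b.pt ∈ V) i j, b.value h (P i j) = φ.vec h.1 i j :=
    fun b h i j => CPoint.value_map iφ h _
  have hQ : ∀ (b : CPoint π) (h : b.pt ∈ V) i j, b.value h (Q i j) = ψ.vec h.2 i j :=
    fun b h i j => CPoint.value_map iψ h _
  obtain ⟨L, hL⟩ := Matrix.exists_mul_eq_one_of_linearIndependent
    (M := Q.map (b.value hbV)) (by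
      have : Q.map (b.value hbV) = Matrix.of (ψ.vec hb') := by
        ext i j
        exact hQ b hbV i j
      rw [this]
      exact ψ.linearIndependent b hb')
  let L' : Matrix (Fin (N + 1)) (Fin (k + 1)) Γ(B, V) := L.map (constHom π V)
  -- At each point `P = G * Q` for some `G`, and then both sides equal `(Q * L').det • (G * Q)`.
  -- Where the determinant is a unit, this writes `P` as a regular matrix times `Q`; at `b` the
  -- determinant is 1 by the choice of `L`.
  have hid : (Q * L').det • P = P * L' * (Q * L').adjugate * Q := by
    ext i j
    rw [← sub_eq_zero]
    refine eq_zero_of_forall_value_eq_zero (π := π) fun b' h => ?_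
    obtain ⟨G, hG⟩ := φ.exists_vec_eq ψ h.1 h.2
    let v := b'.value h
    have hPQ : P.map v = G * Q.map v := by
      ext i j
      rw [Matrix.map_apply, hP, hG, Matrix.mul_apply, Finset.sum_apply]
      exact Finset.sum_congr rfl fun l _ => by rw [Matrix.map_apply, hQ]; rfl
    have key : ((Q * L').det • P).map v = (P * L' * (Q * L').adjugate * Q).map v := by
      have h1 : ((Q * L').det • P).map v = (Q.map v * L'.map v).det • P.map v := by
        rw [← Matrix.map_mul]
        ext i j
        rw [Matrix.map_apply, Matrix.smul_apply, smul_eq_mul, map_mul, RingHom.map_det]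
        rfl
      have h2 : (Q * L').adjugate.map v = (Q.map v * L'.map v).adjugate := by
        rw [← Matrix.map_mul]
        exact RingHom.map_adjugate v _
      rw [h1, Matrix.map_mul, Matrix.map_mul, Matrix.map_mul, h2, hPQ, Matrix.mul_assoc G,
        Matrix.mul_assoc G, Matrix.mul_adjugate, Matrix.mul_assoc, Matrix.smul_mul, Matrix.one_mul,
        Matrix.mul_smul]
    have h3 := congrFun (congrFun key i) j
    rw [Matrix.map_apply, Matrix.map_apply] at h3
    rw [map_sub, sub_eq_zero]
    exact h3
  have hdet : b.value hbV (Q * L').det = 1 := by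
    rw [RingHom.map_det]
    have : (b.value hbV).mapMatrix (Q * L') = Q.map (b.value hbV) * L := by
      rw [RingHom.mapMatrix_apply, Matrix.map_mul]
      congr 1
      ext i j
      exact b.value_constHom hbV _
    rw [this, hL, Matrix.det_one]
  obtain ⟨u, hu⟩ : IsUnit (b.germ hbV (Q * L').det) :=
    b.isUnit_of_ev_ne_zero (by
      change b.value hbV (Q * L').det ≠ 0
      rw [hdet]; exact one_ne_zero)
  refine ⟨Matrix.of fun i l => (u⁻¹ : b.LocalRingˣ) * b.germ hbV ((P * L' * (Q * L').adjugate) i l),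
    fun i j => ?_⟩
  have h1 := congrArg (b.germ hbV) (congrFun (congrFun hid i) j)
  rw [Matrix.smul_apply, smul_eq_mul, map_mul, ← hu, Matrix.mul_apply, map_sum,
    show b.germ hbV (P i j) = b.germ hb (φ.s i j) from germ_map π iφ hbV _,
    ← Units.eq_inv_mul_iff_mul_eq] at h1
  rw [h1, Finset.mul_sum]
  refine Finset.sum_congr rfl fun l _ => ?_
  rw [map_mul, show b.germ hbV (Q l j) = b.germ hb' (ψ.s l j) from germ_map π iψ hbV _,
    Matrix.of_apply, mul_assoc]

/-- Whether the maximal minors of the derivative are proportional along a fibre does not depend on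
the frame. -/
theorem proportionalMinors [IsIntegral B] [LocallyOfFiniteType π] (φ ψ : LocalFrame π k N W)
    {b : CPoint π} (hb : b.pt ∈ φ.U) (hb' : b.pt ∈ ψ.U) (D : Fin m → b.tangentSpace)
    (h : Matrix.ProportionalMinors (ψ.matrix hb' D)) :
    Matrix.ProportionalMinors (φ.matrix hb D) := by
  obtain ⟨G, hG⟩ := φ.exists_germ_eq ψ hb hb'
  -- The coordinates change by the values of `G`. By the Leibniz rule a derivative column acquires
  -- extra terms in the frame vectors, which form the upper right block.
  refine h.of_mul (fun c l => ∑ i, c i * b.ev (G i l))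
    (fun c => Matrix.fromBlocks (Matrix.of fun l i => b.ev (G i l))
      (Matrix.of fun l a => ∑ i, c i * (D a).1 (G i l)) 0 1) fun c => ?_
  ext1 j (i | a)
  · simp only [LocalFrame.matrix, LocalFrame.vec, CPoint.value, RingHom.comp_apply, hG, map_sum,
      map_mul, Matrix.mul_apply, Matrix.of_apply, Sum.elim_inl, Sum.elim_inr,
      Fintype.sum_sum_type, Matrix.fromBlocks_apply₁₁, Matrix.fromBlocks_apply₂₁,
      Matrix.zero_apply, mul_zero, Finset.sum_const_zero, add_zero]
    exact Finset.sum_congr rfl fun _ _ => mul_comm _ _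
  · simp only [LocalFrame.matrix, LocalFrame.vec, CPoint.value, RingHom.comp_apply, hG,
      Matrix.mul_apply, Matrix.of_apply, Sum.elim_inl, Sum.elim_inr,
      Fintype.sum_sum_type, Matrix.fromBlocks_apply₁₂, Matrix.fromBlocks_apply₂₂,
      CPoint.tangentSpace_map_sum, CPoint.tangentSpace_map_mul, Matrix.one_apply, mul_ite, mul_one,
      mul_zero, Finset.sum_ite_eq', Finset.mem_univ, if_true, Finset.mul_sum, Finset.sum_mul,
      mul_add, Finset.sum_add_distrib]
    rw [add_comm]
    congr 1
    · rw [Finset.sum_comm]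
      exact Finset.sum_congr rfl fun _ _ => Finset.sum_congr rfl fun _ _ => by ring
    · rw [Finset.sum_comm]
      exact Finset.sum_congr rfl fun _ _ => Finset.sum_congr rfl fun _ _ => by ring

end LocalFrame

theorem ForGeneral.and [IsIntegral B] {P Q : CPoint π → Prop} (hP : ForGeneral π P)
    (hQ : ForGeneral π Q) : ForGeneral π fun b => P b ∧ Q b := by
  obtain ⟨U, hU, hP⟩ := hP
  obtain ⟨V, hV, hQ⟩ := hQ
  exact ⟨U ⊓ V, nonempty_preirreducible_inter U.isOpen V.isOpen hU hV,
    fun b hb => ⟨hP b hb.1, hQ b hb.2⟩⟩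

theorem ForGeneral.mono {P Q : CPoint π → Prop} (hP : ForGeneral π P) (h : ∀ b, P b → Q b) :
    ForGeneral π Q := by
  obtain ⟨U, hU, hP⟩ := hP
  exact ⟨U, hU, fun b hb => h b (hP b hb)⟩

theorem ForGeneral.exists [LocallyOfFiniteType π] {P : CPoint π → Prop} (hP : ForGeneral π P) :
    ∃ b, P b := by
  obtain ⟨U, hU, hP⟩ := hP
  obtain ⟨b, hb⟩ := exists_cpoint_mem π hU
  exact ⟨b, hP b hb⟩

namespace ParametricScroll

variable (S : ParametricScroll π k N)

/-- In general, the tangent space has dimension `dim B`, and the proportionality of the maximal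
minors of the derivative of the spreading map along a fibre either holds for the general fibre or
fails for the general fibre. -/
theorem forGeneral_proportionalMinors [IsIntegral B] [LocallyOfFiniteType π] :
    ∃ n : ℕ, topologicalKrullDim B = n ∧
      ((ForGeneral π fun b => ∃ e : Module.Basis (Fin n) ℂ b.tangentSpace,
        Matrix.ProportionalMinors (S.fibreMatrix b e)) ∨
      ForGeneral π fun b => ∃ e : Module.Basis (Fin n) ℂ b.tangentSpace,
        ¬ Matrix.ProportionalMinors (S.fibreMatrix b e)) := by
  obtain ⟨b₀, -⟩ := exists_cpoint_mem π (U := ⊤) ⟨Classical.arbitrary B, trivial⟩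
  let φ := S.frame b₀
  obtain ⟨U, n, δ, hU, hUφ, hdim, hδ⟩ := exists_tangentFrame π (V := φ.U)
    ⟨b₀.pt, S.mem_frame b₀⟩
  refine ⟨n, hdim, ?_⟩
  let ι : U ⟶ φ.U := homOfLE hUφ
  let M : (Fin (k + 1) → ℂ) → Matrix (Fin (N + 1)) (Fin (k + 1) ⊕ Fin n) Γ(B, U) := fun c =>
    Matrix.of fun j => Sum.elim (fun i => (B.presheaf.map ι.op).hom (φ.s i j))
      fun a => ∑ i, constHom π U (c i) * δ a ((B.presheaf.map ι.op).hom (φ.s i j))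
  -- For fixed constant coordinate vectors, each cross relation between minors becomes a regular
  -- function on `U`.
  let F : (Fin (k + 1) ⊕ Fin n → Fin (N + 1)) → (Fin (k + 1) ⊕ Fin n → Fin (N + 1)) →
      (Fin (k + 1) → ℂ) → (Fin (k + 1) → ℂ) → Γ(B, U) := fun r r' c c' =>
    ((M c).submatrix r id).det * ((M c').submatrix r' id).det -
      ((M c).submatrix r' id).det * ((M c').submatrix r id).det
  have hM : ∀ (b : CPoint π) (hb : b.pt ∈ U) (e : Module.Basis (Fin n) ℂ b.tangentSpace)
      (_ : ∀ a f, (e a).1 (b.germ hb f) = b.value hb (δ a f)) c r,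
      b.value hb ((M c).submatrix r id).det =
        ((φ.matrix (hUφ hb) e c).submatrix r id).det := fun b hb e he c r => by
    rw [RingHom.map_det]
    congr 1
    ext i (j | a)
    · exact CPoint.value_map ι hb _
    · simp only [M, LocalFrame.matrix, RingHom.mapMatrix_apply, Matrix.map_apply,
        Matrix.submatrix_apply, Matrix.of_apply, id, Sum.elim_inr, map_sum, map_mul,
        CPoint.value_constHom, ← he]
      exact Finset.sum_congr rfl fun l _ => by rw [germ_map]
  have hF : ∀ (b : CPoint π) (hb : b.pt ∈ U), ∃ e : Module.Basis (Fin n) ℂ b.tangentSpace,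
      Matrix.ProportionalMinors (S.fibreMatrix b e) ↔
        ∀ r r' c c', b.value hb (F r r' c c') = 0 := fun b hb => by
    obtain ⟨e, he⟩ := hδ b hb
    refine ⟨e, ?_⟩
    have h1 : Matrix.ProportionalMinors (S.fibreMatrix b e) ↔
        Matrix.ProportionalMinors (φ.matrix (hUφ hb) e) :=
      ⟨φ.proportionalMinors _ _ _ _, (S.frame b).proportionalMinors _ _ _ _⟩
    rw [h1]
    simp only [F, map_sub, map_mul, hM b hb e he, sub_eq_zero]
    rfl
  by_cases h0 : ∀ r r' c c', F r r' c c' = 0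
  · refine .inl ⟨U, hU, fun b hb => ?_⟩
    obtain ⟨e, he⟩ := hF b hb
    exact ⟨e, he.mpr fun r r' c c' => by rw [h0, map_zero]⟩
  · push Not at h0
    obtain ⟨r, r', c, c', h0⟩ := h0
    refine .inr ⟨B.basicOpen (F r r' c c'), ?_, fun b hb => ?_⟩
    · rw [← not_not (a := Set.Nonempty _), TopologicalSpace.Opens.not_nonempty_iff_eq_bot,
        basicOpen_eq_bot_iff]
      exact h0
    · have hbU := B.basicOpen_le _ hb
      obtain ⟨e, he⟩ := hF b hbU
      exact ⟨e, fun h => (b.value_ne_zero_iff hbU _).mpr hb (he.mp h r r' c c')⟩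

end ParametricScroll

end FrameChange

/-! ### From single fibres to the general fibre. -/

theorem mainTheorem7 {B : Scheme.{0}} (π : B ⟶ Spec (.of ℂ)) [IsIntegral B] [IsSeparated π]
    [LocallyOfFiniteType π] [QuasiCompact π] (k N : ℕ) (S : ParametricScroll π k N)
    (hfin : S.GenericallyFinite)
    (hfocal : ForGeneral π fun b => ∃ d g, S.IsFocalHypersurface b d g) :
    ForGeneral π fun b => ∀ d g, S.IsFocalHypersurface b d g →
      (d : WithBot ℕ∞) ≤ topologicalKrullDim B ∧
      ((d : WithBot ℕ∞) = topologicalKrullDim B ↔ S.IsStationary) := by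
  obtain ⟨n, hdim, h | h⟩ := S.forGeneral_proportionalMinors
  · have hS : ForGeneral π S.IsStationaryAt := (hfocal.and h).mono fun b hb => by
      obtain ⟨⟨d, g, hg⟩, e, he⟩ := hb
      obtain ⟨r, hr⟩ := hg.exists_minor_ne_zero e
      exact ParametricScroll.isStationaryAt_of_proportionalMinors e he hr
    refine (h.and hS).mono fun b hb d g hg => ?_
    obtain ⟨⟨e, -⟩, hSb⟩ := hb
    have hd : d = n := le_antisymm (hg.degree_le e) (hg.le_degree e hSb)
    rw [hdim, hd]
    exact ⟨le_rfl, fun _ => hS, fun _ => rfl⟩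
  · refine h.mono fun b hb d g hg => ?_
    obtain ⟨e, he⟩ := hb
    rw [hdim]
    refine ⟨by exact_mod_cast hg.degree_le e, fun hd => ?_, fun hS => ?_⟩
    · obtain rfl : d = n := by exact_mod_cast hd
      exact absurd (hg.proportionalMinors e) he
    -- Stationarity says nothing about the given `b`. At a point `b'` general for all three
    -- conditions it forces full degree, hence proportional minors, which are excluded there.
    · obtain ⟨b', ⟨⟨d', g', hg'⟩, e', he'⟩, hS'⟩ := ((hfocal.and h).and hS).exists
      have hd' : d' = n := le_antisymm (hg'.degree_le e') (hg'.le_degree e' hS')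
      subst hd'
      exact absurd (hg'.proportionalMinors e') he'
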